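/- **Setting.** Let $d,n\ge 1$, $T>0$, $\alpha\in(\tfrac14,\tfrac13]$ and $N=3$. For a finite alphabet $B$, let $\mathcal F_B$ be the set of $B$-decorated planar rooted forests (finite ordered sequences of planar rooted trees), with empty forest $\mathbf 1$; $|\tau|$ is the number of vertices of $\tau$, $[\tau]_b$ is the tree obtained by grafting the trees of $\tau$, in order, on a new root decorated by $b$, and $\bullet_b=[\mathbf 1]_b$. On $\mathbb R\mathcal F_B$ let $\mathbin{\sqcup\!\sqcup}$ be the shuffle product of words in planar trees, and let $\Delta$ be the Munthe-Kaas–Wright coproduct (left admissible cuts): $\Delta\mathbf 1=\mathbf 1\otimes\mathbf 1$ and $$\Delta(\omega[\sigma]_b)=\omega[\sigma]_b\otimes\mathbf 1+\Delta(\omega)\cdot(\mathrm{id}\otimes[\,\cdot\,]_b)\Delta(\sigma),$$ where $\cdot$ is the shuffle on the left and concatenation on the right tensor factors. Let $\star$ be the dual product, $\langle x\star y,\tau\rangle=\langle x\otimes y,\Delta\tau\rangle$. Give each letter $b\in B$ a weight $w(b)\in\mathbb N$, and let $w(\tau)$ be the sum of the weights of the decorations of $\tau$. An $\alpha$-Hölder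 planarly branched rough path over $(B,w)$ (with truncation $3$) is a family $\mathbf X_{s,t}$, $s,t\in[0,T]$, of functionals on the span of the forests with at most $3$ vertices such that, for all $s,u,t\in[0,T]$: $\mathbf X_{s,u}\star\mathbf X_{u,t}=\mathbf X_{s,t}$; $\langle\mathbf X_{s,t},\mathbf 1\rangle=1$ and $\langle\mathbf X_{s,t},\sigma\mathbin{\sqcup\!\sqcup}\tau\rangle=\langle\mathbf X_{s,t},\sigma\rangle\langle\mathbf X_{s,t},\tau\rangle$ whenever $|\sigma|+|\tau|\le3$; and $\sup_{s\ne t}|\langle\mathbf X_{s,t},\tau\rangle|/|t-s|^{w(\tau)\alpha}<\infty$ for $|\tau|\le 3$. A path $\mathbf Y$ with coordinates $\langle\tau,\mathbf Y_t\rangle\in\mathbb R^n$, $|\tau|\le2$, is $\mathbf X$-controlled if for every $|\tau|\le 2$, uniformly in $s,t\in[0,T]$, $\langle\tau,\mathbf Y_t\rangle-\langle\mathbf X_{s,t}\star\tau,\mathbf Y_s\rangle=O(|t-s|^{(3-|\tau|)\alpha})$. Its rough integral against the component $b\in B$ is the function $I_t=\int_0^t Y_r\,dX^b_r$ with $$I_t=\lim_{|\pi|\to0}\sum_{[u,v]\in\pi}\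 \sum_{|\tau|\le2}\langle\tau,\mathbf Y_u\rangle\langle\mathbf X_{u,v},[\tau]_b\rangle$$ ($\pi$ a partition of $[0,t]$) and $I_t-I_s=\sum_{|\tau|\le2}\langle\tau,\mathbf Y_s\rangle\langle\mathbf X_{s,t},[\tau]_b\rangle+O(|t-s|^{4\alpha})$; $\int_s^t$ denotes $I_t-I_s$. **Theorem.** Let $A=\{1,\dots,d\}$, all letters having weight $1$, let $\mathbf X$ be an $\alpha$-Hölder planarly branched rough path over $A$, above $X=(X^1,\dots,X^d):[0,T]\to\mathbb R^d$, i.e. $\langle\mathbf X_{s,t},\bullet_i\rangle=X^i_t-X^i_s$. Let $\hat{\mathbf X}$ be a bracket extension of $\mathbf X$: an $\alpha$-Hölder planarly branched rough path over $\bar A=A\cup\{(ij)\mid i,j\in A\}$, where the letters $i$ have weight $1$ and the letters $(ij)$ have weight $2$, such that $\langle\hat{\mathbf X}_{s,t},\tau\rangle=\langle\mathbf X_{s,t},\tau\rangle$ for all $A$-decorated $\tau$ with $|\tau|\le3$ and $\langle\hat{\mathbf X}_{s,t},\bullet_{(ij)}\rangle=\langle\mathbf X_{s,t},\bullet_j\bullet_i-[\bullet_j]_i\rangle$;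 write $\hat X^{(ij)}$ for the component $(ij)$ of $\hat{\mathbf X}$. Let $F:\mathbb R^d\to\mathbb R^n$ be smooth. Then for all $i,j,k\in A$ there is, for any given initial value, a path $\tilde X^{(ijk)}:[0,T]\to\mathbb R$ with $$\tilde X^{(ijk)}_t-\tilde X^{(ijk)}_s=\big\langle\hat{\mathbf X}_{s,t},\ \bullet_k\bullet_j\bullet_i-[\bullet_k\bullet_j]_i-[\bullet_k]_{(ij)}\big\rangle,\qquad s,t\in[0,T],$$ and for any such paths all the following integrals exist and, for all $s,t\in[0,T]$, $$F(X_t)-F(X_s)=\sum_{i=1}^d\int_s^t\partial_iF(X_r)\,dX^i_r+\sum_{i,j=1}^d\int_s^t\partial_i\partial_jF(X_r)\,d\hat X^{(ij)}_r+\sum_{i,j,k=1}^d\int_s^t\partial_i\partial_j\partial_kF(X_r)\,d\tilde X^{(ijk)}_r .$$ The first integrals are rough integrals with respect to $\mathbf X$, the second ones rough integrals with respect to $\hat{\mathbf X}$; in them $G(X)$ (for $G=\partial_iF$, $\partial_i\partial_jF$) is lifted to the controlled path with coordinates $G(X_t)$ on $\mathbf 1$, $\partial_iG(X_t)$ on $\bullet_i$,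 $\partial_i\partial_jG(X_t)$ on $\bullet_i\bullet_j$ ($i,j\in A$), and $0$ on all other forests. The third ones are Young integrals: the integrand is $\alpha$-Hölder, the integrator is $3\alpha$-Hölder, $\alpha+3\alpha>1$, and the integral over $[0,t]$ is the limit of the sums $\sum_{[u,v]\in\pi}\partial_i\partial_j\partial_kF(X_u)(\tilde X^{(ijk)}_v-\tilde X^{(ijk)}_u)$ over partitions $\pi$ of $[0,t]$ as $|\pi|\to0$ (again $\int_s^t:=\int_0^t-\int_0^s$). -/

import Mathlib

open scoped ContDiff

namespace PlanarRP

/-! ### Planar forests and the Munthe-Kaas--Wright coalgebra -/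

/-- `A`-decorated planar rooted forests. A forest is either empty, or it is obtained from a forest
`φ` by appending on the right one more planar rooted tree `[c]_a`, whose root is decorated by `a`
and whose (ordered) branches are the trees of the forest `c`. -/
inductive PForest (A : Type*) : Type _
  | nil : PForest A
  | snoc (φ : PForest A) (a : A) (c : PForest A) : PForest A

namespace PForest

variable {A B : Type*}

/-- The tree `[τ]_a`: the trees of `τ` grafted on a new root decorated by `a`. -/
def graft (a : A) (τ : PForest A) : PForest A := snoc nil a τ

/-- The one-vertex tree `•_a`. -/
def dot (a : A) : PForest A := graft a nil

/-- Concatenation (juxtaposition) of planar forests. -/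
def concat (σ : PForest A) : PForest A → PForest A
  | nil => σ
  | snoc φ a c => snoc (concat σ φ) a c

/-- The number of vertices of a forest. -/
def order : PForest A → ℕ
  | nil => 0
  | snoc φ _ c => order φ + 1 + order c

/-- The weight of a forest, if a vertex decorated by `a` has weight `w a`. -/
def weight (w : A → ℕ) : PForest A → ℕ
  | nil => 0
  | snoc φ a c => weight w φ + w a + weight w c

/-- Change of decorations. -/
def map (f : A → B) : PForest A → PForest B
  | nil => nil
  | snoc φ a c => snoc (map f φ) (f a) (map f c)

/-- The shuffle product of two forests, as words in planar trees: the formal sum of forests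
`σ ⧢ τ`, as the list of its terms, repeated with multiplicity. -/
def shuffle : PForest A → PForest A → List (PForest A)
  | nil, τ => [τ]
  | snoc φ a c, nil => [snoc φ a c]
  | snoc φ a c, snoc φ' b c' =>
      (shuffle φ (snoc φ' b c')).map (fun ρ => snoc ρ a c) ++
        (shuffle (snoc φ a c) φ').map (fun ρ => snoc ρ b c')
termination_by σ τ => order σ + order τ
decreasing_by all_goals (simp only [order]; omega)

/-- The MKW coproduct (left admissible cuts), as the list of the terms `P ⊗ R` of the formal sum,
repeated with multiplicity; `P` is the pruned part and `R` contains the roots. It is given by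
`Δ(1) = 1 ⊗ 1` and `Δ(φ [c]_a) = φ [c]_a ⊗ 1 + Δ(φ) · (id ⊗ [ - ]_a) Δ(c)`, where the dot is the
shuffle product on the left factors and concatenation on the right factors. -/
def coprod : PForest A → List (PForest A × PForest A)
  | nil => [(nil, nil)]
  | snoc φ a c =>
      (snoc φ a c, nil) ::
        (coprod φ).flatMap fun p =>
          (coprod c).flatMap fun q =>
            (shuffle p.1 q.1).map fun ρ => (ρ, concat p.2 (graft a q.2))

/-- There are finitely many forests with at most `m` vertices over a finite alphabet. -/
theorem finite_order_le [Finite A] (m : ℕ) : {τ : PForest A | order τ ≤ m}.Finite := by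
  induction m with
  | zero =>
      refine (Set.finite_singleton (nil : PForest A)).subset ?_
      rintro (_ | ⟨φ, a, c⟩) h
      · rfl
      · simp only [Set.mem_ofPred_eq, order] at h
        omega
  | succ m ih =>
      refine ((Set.finite_singleton (nil : PForest A)).union
        ((ih.prod ((Set.finite_univ (α := A)).prod ih)).image
          fun p => snoc p.1 p.2.1 p.2.2)).subset ?_
      rintro (_ | ⟨φ, a, c⟩) h
      · exact Or.inl rfl
      · simp only [Set.mem_ofPred_eq, order] at h
        refine Or.inr ⟨(φ, a, c), ⟨?_, Set.mem_univ _, ?_⟩, rfl⟩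
        · show order φ ≤ m
          omega
        · show order c ≤ m
          omega

/-- The finite set `𝓕^{≤ m}` of forests with at most `m` vertices. -/
noncomputable def forestsLE (A : Type*) [Finite A] (m : ℕ) : Finset (PForest A) :=
  (finite_order_le (A := A) m).toFinset

open Classical in
/-- The basis functional dual to the forest `τ`. -/
noncomputable def dual (τ : PForest A) : PForest A → ℝ := fun σ => if σ = τ then 1 else 0

/-- The product `⋆` dual to the MKW coproduct, on functionals given by their coordinates:
`⟨x ⋆ y, τ⟩ = ⟨x ⊗ y, Δ τ⟩`. -/
def star (x y : PForest A → ℝ) (τ : PForest A) : ℝ :=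
  ((coprod τ).map fun p => x p.1 * y p.2).sum

end PForest

open PForest

/-! ### Rough paths, controlled rough paths and rough integrals

An element of the dual of the MKW Hopf algebra, truncated at `N` vertices, is given by its
coordinates `⟨x, τ⟩ = x τ`; only those with `order τ ≤ N` are ever used. -/

section

variable {A : Type*}

/-- Planarly branched rough path on `[0,T]`, truncated at forests with `N` vertices, such that the
coordinate of `τ` is Hölder of exponent `α` times the weight of `τ`. -/
structure IsRoughPath (w : A → ℕ) (α : ℝ) (N : ℕ) (T : ℝ)
    (X : ℝ → ℝ → PForest A → ℝ) : Prop where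
  chen : ∀ s ∈ Set.Icc 0 T, ∀ u ∈ Set.Icc 0 T, ∀ t ∈ Set.Icc 0 T,
    ∀ τ : PForest A, order τ ≤ N → star (X s u) (X u t) τ = X s t τ
  unit : ∀ s ∈ Set.Icc 0 T, ∀ t ∈ Set.Icc 0 T, X s t nil = 1
  mul : ∀ s ∈ Set.Icc 0 T, ∀ t ∈ Set.Icc 0 T,
    ∀ σ τ : PForest A, order σ + order τ ≤ N →
      ((shuffle σ τ).map (X s t)).sum = X s t σ * X s t τ
  holder : ∀ τ : PForest A, order τ ≤ N → ∃ C : ℝ,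
    ∀ s ∈ Set.Icc 0 T, ∀ t ∈ Set.Icc 0 T, s ≠ t →
      |X s t τ| ≤ C * |t - s| ^ ((weight w τ : ℝ) * α)

/-- An `α`-Hölder planarly branched rough path: every vertex has weight one. -/
def IsPlanarlyBranchedRoughPath (α : ℝ) (N : ℕ) (T : ℝ) (X : ℝ → ℝ → PForest A → ℝ) : Prop :=
  IsRoughPath (fun _ => 1) α N T X

variable {E : Type*} [NormedAddCommGroup E] [NormedSpace ℝ E]

/-- The remainder `⟨τ, Y_t⟩ - ⟨X_{s,t} ⋆ τ, Y_s⟩`, for a path `Y` with coordinates `⟨σ, Y_t⟩ = Y t σ`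
on the forests with at most `N - 1` vertices. -/
noncomputable def remainder [Finite A] (N : ℕ) (X : ℝ → ℝ → PForest A → ℝ)
    (Y : ℝ → PForest A → E) (τ : PForest A) (s t : ℝ) : E :=
  Y t τ - ∑ σ ∈ forestsLE A (N - 1), star (X s t) (dual τ) σ • Y s σ

/-- `Y` is an `X`-controlled planarly branched rough path. -/
def IsControlled [Finite A] (α : ℝ) (N : ℕ) (T : ℝ) (X : ℝ → ℝ → PForest A → ℝ)
    (Y : ℝ → PForest A → E) : Prop :=
  ∀ τ : PForest A, order τ ≤ N - 1 → ∃ C : ℝ, ∀ s ∈ Set.Icc 0 T, ∀ t ∈ Set.Icc 0 T,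
    ‖remainder N X Y τ s t‖ ≤ C * |t - s| ^ (((N : ℝ) - order τ) * α)

/-- `I` is the limit, as the mesh tends to zero, of the sums of `Ξ` over the partitions
`a = p 0 < p 1 < ⋯ < p m = b` of `[a, b]`. -/
def IsRiemannLimit (Ξ : ℝ → ℝ → E) (a b : ℝ) (I : E) : Prop :=
  ∀ ε > 0, ∃ δ > 0, ∀ (m : ℕ) (p : ℕ → ℝ), p 0 = a → p m = b →
    (∀ k < m, p k < p (k + 1) ∧ p (k + 1) - p k < δ) →
      ‖∑ k ∈ Finset.range m, Ξ (p k) (p (k + 1)) - I‖ < ε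

/-- The compensated increment `∑_{|τ| ≤ N-1} ⟨τ, Y_s⟩ ⟨X_{s,t}, [τ]_a⟩`. -/
noncomputable def germ [Finite A] (N : ℕ) (X : ℝ → ℝ → PForest A → ℝ)
    (Y : ℝ → PForest A → E) (a : A) (s t : ℝ) : E :=
  ∑ τ ∈ forestsLE A (N - 1), X s t (graft a τ) • Y s τ

/-- `t ↦ I t` is the rough integral `∫_0^t Y dX^a` of the `X`-controlled path `Y` against the
component `X^a`; `∫_s^t Y dX^a` is `I t - I s`. -/
structure IsRoughIntegral [Finite A] (α : ℝ) (N : ℕ) (T : ℝ) (X : ℝ → ℝ → PForest A → ℝ)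
    (Y : ℝ → PForest A → E) (a : A) (I : ℝ → E) : Prop where
  controlled : IsControlled α N T X Y
  riemann : ∀ t ∈ Set.Icc 0 T, IsRiemannLimit (germ N X Y a) 0 t (I t)
  estimate : ∃ C : ℝ, ∀ s ∈ Set.Icc 0 T, ∀ t ∈ Set.Icc 0 T,
    ‖I t - I s - germ N X Y a s t‖ ≤ C * |t - s| ^ (((N : ℝ) + 1) * α)

/-- Hölder continuity of exponent `β` on `[0,T]`. -/
def IsHolder (β T : ℝ) (g : ℝ → E) : Prop :=
  ∃ C : ℝ, ∀ s ∈ Set.Icc 0 T, ∀ t ∈ Set.Icc 0 T, ‖g t - g s‖ ≤ C * |t - s| ^ β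

/-- `t ↦ I t` is the Young integral `∫_0^t g dx` of a `β`-Hölder path `g` against a `γ`-Hölder
path `x`, where `β + γ > 1`; `∫_s^t g dx` is `I t - I s`. -/
structure IsYoungIntegral (β γ T : ℝ) (g : ℝ → E) (x : ℝ → ℝ) (I : ℝ → E) : Prop where
  one_lt : 1 < β + γ
  integrand : IsHolder β T g
  integrator : IsHolder γ T x
  riemann : ∀ t ∈ Set.Icc 0 T, IsRiemannLimit (fun u v => (x v - x u) • g u) 0 t (I t)

end

/-! ### Composition with smooth functions -/

section

variable {d : ℕ} {E : Type*} [NormedAddCommGroup E] [NormedSpace ℝ E]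

/-- The partial derivative `∂_i G`. -/
noncomputable def pderiv (i : Fin d) (G : EuclideanSpace ℝ (Fin d) → E) :
    EuclideanSpace ℝ (Fin d) → E :=
  fun x => fderiv ℝ G x (EuclideanSpace.single i 1)

/-- The lift `G(𝐗)` of `G(X)` for truncation `N = 3`: its coordinates are `G(X_t)` on the empty
forest, `∂_i G(X_t)` on `•_i`, `∂_i ∂_j G(X_t)` on `•_i •_j`, and `0` on every other forest. -/
noncomputable def lift (G : EuclideanSpace ℝ (Fin d) → E) (X : ℝ → EuclideanSpace ℝ (Fin d))
    (t : ℝ) : PForest (Fin d) → E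
  | .nil => G (X t)
  | .snoc .nil i .nil => pderiv i G (X t)
  | .snoc (.snoc .nil i .nil) j .nil => pderiv i (pderiv j G) (X t)
  | _ => 0

end

/-! ### Bracket extension -/

/-- The alphabet `A ∪ {(ij)}`, where `A = {1, …, d}`: `Sum.inl i` is the letter `i`, and
`Sum.inr (i, j)` is the letter `(ij)`. -/
abbrev BracketAlphabet (d : ℕ) : Type := Fin d ⊕ (Fin d × Fin d)

/-- A letter `i` has weight one and a letter `(ij)` has weight two. -/
def bracketWeight {d : ℕ} : BracketAlphabet d → ℕ
  | .inl _ => 1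
  | .inr _ => 2

/-- Forests decorated by `A`, as forests decorated by the larger alphabet. -/
def incl {d : ℕ} : PForest (Fin d) → PForest (BracketAlphabet d) := PForest.map Sum.inl

/-- A path with coordinates on the `A`-decorated forests, as a path with coordinates on all forests
over the larger alphabet (zero on the new forests). -/
noncomputable def extendByZero {d : ℕ} {E : Type*} [Zero E] (Y : ℝ → PForest (Fin d) → E)
    (t : ℝ) : PForest (BracketAlphabet d) → E :=
  Function.extend incl (Y t) (fun _ => 0)

/-- `Xh` is a bracket extension of the rough path `X`. -/
structure IsBracketExtension {d : ℕ} (α : ℝ) (N : ℕ) (T : ℝ)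
    (X : ℝ → ℝ → PForest (Fin d) → ℝ) (Xh : ℝ → ℝ → PForest (BracketAlphabet d) → ℝ) : Prop where
  isRoughPath : IsRoughPath bracketWeight α N T Xh
  extends_eq : ∀ s ∈ Set.Icc 0 T, ∀ t ∈ Set.Icc 0 T, ∀ τ : PForest (Fin d), order τ ≤ N →
    Xh s t (incl τ) = X s t τ
  bracket_eq : ∀ s ∈ Set.Icc 0 T, ∀ t ∈ Set.Icc 0 T, ∀ i j : Fin d,
    Xh s t (dot (Sum.inr (i, j))) = X s t (concat (dot j) (dot i)) - X s t (graft i (dot j))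

/-- `⟨Xh_{s,t}, •_k •_j •_i - [•_k •_j]_i - [•_k]_{(ij)}⟩`. -/
def tildeIncrement {d : ℕ} (Xh : ℝ → ℝ → PForest (BracketAlphabet d) → ℝ) (i j k : Fin d)
    (s t : ℝ) : ℝ :=
  Xh s t (incl (concat (concat (dot k) (dot j)) (dot i)))
    - Xh s t (incl (graft i (concat (dot k) (dot j))))
    - Xh s t (graft (Sum.inr (i, j)) (dot (Sum.inl k)))

/-- `Xt i j k` is a path on `[0,T]` whose increments are the numbers `tildeIncrement Xh i j k`. -/
def IsTildePath {d : ℕ} (T : ℝ) (Xh : ℝ → ℝ → PForest (BracketAlphabet d) → ℝ)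
    (Xt : Fin d → Fin d → Fin d → ℝ → ℝ) : Prop :=
  ∀ i j k, ∀ s ∈ Set.Icc 0 T, ∀ t ∈ Set.Icc 0 T,
    Xt i j k t - Xt i j k s = tildeIncrement Xh i j k s t

end PlanarRP

/-! The formula follows by comparing local expansions. Since 4α > 1, the sewing lemma
(`exists_sewing`) turns a germ whose defect is of order 4α into a path whose increments it
approximates to order 4α; all three kinds of integral arise in this way. Once the increment of F(X)
agrees with the sum of the germs up to order 4α (`IsBracketExtension.small_ito_defect`), the
difference of the two sides is a path with increments of order 4α, hence constant
(`eq_of_norm_sub_le_rpow`).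

The expansion is Taylor's formula of order three. The shuffle relations and the symmetry of
derivatives turn the powers of X_t - X_s, with their factors 1/2 and 1/6, into sums of the ordered
coordinates •_j•_i and •_k•_j•_i. The first germs contribute the trees [•_j]_i and [•_k•_j]_i, and
the bracket germs contribute •_j•_i - [•_j]_i and [•_k]_{(ij)}. The increment of the tilde path is
exactly what is then missing at third order (`sum_germs`). The terms [•_k•_l]_{(ij)} left over have
weight four and are negligible.

The rough germs can be sewn because Chen's relation on [τ]_a writes their defect as the Taylor
remainders of G(X), which are also its controlled-path remainders, times coordinates of
complementary order: 1+3, 2+2, 3+1 (`germ_defect`). The tilde increments are additive because the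
cross terms in Chen's relation cancel by the definition of the bracket
(`IsBracketExtension.tildeIncrement_add`).

Both rough paths are treated at once through `IsRoughPathAbove`, with an embedding of the letters of
X into the alphabet. -/

namespace PlanarRP

open Filter Topology

/-! ### Sewing and Riemann sums. -/

section Sewing

variable {E : Type*} [NormedAddCommGroup E]

/-- Young's maximal inequality for the sums of an almost additive two-parameter function. -/
theorem norm_sum_sub_le {Ξ : ℝ → ℝ → E} {a b C K θ : ℝ} (hC : 0 ≤ C) (hK0 : 0 ≤ K) (hθ : 0 < θ)
    (hK : 2 * C + 2 * K * (1 / 2) ^ θ ≤ K) (hΞ₀ : ∀ s ∈ Set.Icc a b, Ξ s s = 0)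
    (hΞ : ∀ s ∈ Set.Icc a b, ∀ u ∈ Set.Icc a b, ∀ t ∈ Set.Icc a b, s ≤ u → u ≤ t →
      ‖Ξ s t - Ξ s u - Ξ u t‖ ≤ C * (t - s) ^ θ)
    (m : ℕ) (p : ℕ → ℝ) (hp : Monotone p) (hpm : ∀ k, p k ∈ Set.Icc a b) :
    ‖∑ k ∈ Finset.range m, Ξ (p k) (p (k + 1)) - Ξ (p 0) (p m)‖ ≤ K * (p m - p 0) ^ θ := by
  induction m using Nat.strong_induction_on generalizing p with
  | _ m ih =>
  rcases m with _ | m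
  · simp [hΞ₀ _ (hpm 0), Real.zero_rpow hθ.ne']
  -- Bisect at the midpoint of the interval rather than at the middle index: the blocks on either
  -- side of the cell containing `c` both have length at most half, and only two defects are paid
  -- for splitting off that cell.
  set c := (p 0 + p (m + 1)) / 2 with hc
  have h0m : p 0 ≤ p (m + 1) := hp (Nat.zero_le _)
  obtain ⟨j, hjm, hj1, hj2⟩ : ∃ j ≤ m, p j ≤ c ∧ c ≤ p (j + 1) := by
    classical
    refine ⟨Nat.findGreatest (fun k => p k ≤ c) m, Nat.findGreatest_le m,
      Nat.findGreatest_spec (P := fun k => p k ≤ c) (Nat.zero_le m) (by linarith), ?_⟩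
    rcases (Nat.findGreatest_le (P := fun k => p k ≤ c) m).lt_or_eq with h | h
    · exact (not_le.1 (Nat.findGreatest_is_greatest (P := fun k => p k ≤ c)
        (Nat.lt_succ_self _) h)).le
    · rw [h]; linarith
  obtain ⟨r, rfl⟩ := Nat.exists_eq_add_of_le hjm
  have hL := ih j (by omega) p hp hpm
  have hR := ih r (by omega) (fun k => p (j + 1 + k)) (fun x y hxy => hp (by omega))
    (fun k => hpm _)
  have e : j + r + 1 = j + 1 + r := by omega
  rw [e] at hc h0m ⊢
  simp only [add_zero] at hR
  have hsum : ∑ k ∈ Finset.range (j + 1 + r), Ξ (p k) (p (k + 1)) - Ξ (p 0) (p (j + 1 + r))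
      = (∑ k ∈ Finset.range j, Ξ (p k) (p (k + 1)) - Ξ (p 0) (p j))
        + (∑ k ∈ Finset.range r, Ξ (p (j + 1 + k)) (p (j + 1 + k + 1))
            - Ξ (p (j + 1)) (p (j + 1 + r)))
        - (Ξ (p 0) (p (j + 1)) - Ξ (p 0) (p j) - Ξ (p j) (p (j + 1)))
        - (Ξ (p 0) (p (j + 1 + r)) - Ξ (p 0) (p (j + 1)) - Ξ (p (j + 1)) (p (j + 1 + r))) := by
    rw [Finset.sum_range_add, Finset.sum_range_succ]; abel
  have h1 : p 0 ≤ p j := hp (Nat.zero_le _)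
  have h2 : p j ≤ p (j + 1) := hp (Nat.le_succ _)
  have h3 : p (j + 1) ≤ p (j + 1 + r) := hp (Nat.le_add_right _ _)
  set L := p (j + 1 + r) - p 0 with hLdef
  have hL0 : 0 ≤ L := sub_nonneg.2 h0m
  have hhalf : ∀ x, 0 ≤ x → x ≤ L / 2 → K * x ^ θ ≤ K * ((1 / 2) ^ θ * L ^ θ) := by
    intro x hx hxL
    rw [← Real.mul_rpow (by norm_num) hL0]
    gcongr; linarith
  have b1 := hL.trans (hhalf _ (by linarith) (by linarith))
  have b2 := hR.trans (hhalf _ (by linarith) (by linarith))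
  have b3 := hΞ _ (hpm 0) _ (hpm j) _ (hpm (j + 1)) h1 h2
  have b3' : C * (p (j + 1) - p 0) ^ θ ≤ C * L ^ θ :=
    mul_le_mul_of_nonneg_left (Real.rpow_le_rpow (by linarith) (by linarith) hθ.le) hC
  have b4 := hΞ _ (hpm 0) _ (hpm (j + 1)) _ (hpm (j + 1 + r)) (h1.trans h2) h3
  rw [hsum]
  have hLθ : 0 ≤ L ^ θ := by positivity
  calc _ ≤ K * ((1 / 2) ^ θ * L ^ θ) + K * ((1 / 2) ^ θ * L ^ θ) + C * L ^ θ + C * L ^ θ := by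
        refine (norm_sub_le _ _).trans (add_le_add ((norm_sub_le _ _).trans (add_le_add
          ((norm_add_le _ _).trans (add_le_add b1 b2)) (b3.trans b3'))) b4)
    _ = (2 * C + 2 * K * (1 / 2) ^ θ) * L ^ θ := by ring
    _ ≤ K * L ^ θ := by gcongr

/-- The sewing lemma. -/
theorem exists_sewing [ProperSpace E] {Ξ : ℝ → ℝ → E} {T C θ : ℝ} (hT : 0 < T) (hC : 0 ≤ C)
    (hθ : 1 < θ) (hΞ₀ : ∀ s ∈ Set.Icc 0 T, Ξ s s = 0)
    (hΞ : ∀ s ∈ Set.Icc 0 T, ∀ u ∈ Set.Icc 0 T, ∀ t ∈ Set.Icc 0 T, s ≤ u → u ≤ t →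
      ‖Ξ s t - Ξ s u - Ξ u t‖ ≤ C * (t - s) ^ θ) :
    ∃ (I : ℝ → E) (K : ℝ), 0 ≤ K ∧ I 0 = 0 ∧ ∀ s ∈ Set.Icc 0 T, ∀ t ∈ Set.Icc 0 T, s ≤ t →
      ‖I t - I s - Ξ s t‖ ≤ K * (t - s) ^ θ := by
  have hθ0 : 0 < θ := by linarith
  have hhalf : 2 * (1 / 2 : ℝ) ^ θ < 1 := by
    have : (1 / 2 : ℝ) ^ θ < (1 / 2) ^ (1 : ℝ) :=
      Real.rpow_lt_rpow_of_exponent_gt (by norm_num) (by norm_num) hθ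
    rw [Real.rpow_one] at this; linarith
  -- The witness solves the equation K = 2C + 2K(1/2)^θ; this is where θ > 1 is needed.
  obtain ⟨K, hK0, hK⟩ : ∃ K : ℝ, 0 ≤ K ∧ 2 * C + 2 * K * (1 / 2) ^ θ ≤ K := by
    have hpos : 0 < 1 - 2 * (1 / 2 : ℝ) ^ θ := by linarith
    refine ⟨2 * C / (1 - 2 * (1 / 2) ^ θ), by positivity, le_of_eq ?_⟩
    field_simp
    ring
  have hmax := fun m p => norm_sum_sub_le (m := m) (p := p) hC hK0 hθ0 hK hΞ₀ hΞ
  -- grid points, and their truncations to `[s, t]`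
  let g : ℕ → ℕ → ℝ := fun m k => T / (m + 1) * k
  let q : ℕ → ℝ → ℝ → ℕ → ℝ := fun m s t k => max s (min (g m k) t)
  let J : ℕ → ℝ → ℝ → E := fun m s t => ∑ k ∈ Finset.range (m + 1), Ξ (q m s t k) (q m s t (k + 1))
  have hg : ∀ m, Monotone (g m) := fun m x y hxy => by simp only [g]; gcongr
  have hgm : ∀ m, g m (m + 1) = T := fun m => by simp only [g]; push_cast; field_simp
  have hg0 : ∀ m, g m 0 = 0 := fun m => by simp [g]
  have hgnn : ∀ m k, 0 ≤ g m k := fun m k => by simp only [g]; positivity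
  have hgs : ∀ m k, g m (k + 1) - g m k = T / (m + 1) := fun m k => by
    simp only [g]; push_cast; ring
  have hq : ∀ m s t, Monotone (q m s t) := fun m s t x y hxy =>
    max_le_max le_rfl (min_le_min (hg m hxy) le_rfl)
  have hqs : ∀ m s t, s ≤ t → ∀ k, q m s t k ∈ Set.Icc s t := fun m s t hst k =>
    ⟨le_max_left _ _, max_le hst (min_le_right _ _)⟩
  have hJ : ∀ m, ∀ s ∈ Set.Icc 0 T, ∀ t ∈ Set.Icc 0 T, s ≤ t →
      ‖J m s t - Ξ s t‖ ≤ K * (t - s) ^ θ := by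
    intro m s hs t ht hst
    have := hmax (m + 1) (q m s t) (hq m s t)
      (fun k => ⟨hs.1.trans (hqs m s t hst k).1, (hqs m s t hst k).2.trans ht.2⟩)
    have e0 : q m s t 0 = s := by
      simp only [q, hg0]; exact max_eq_left ((min_le_left _ _).trans hs.1)
    have e1 : q m s t (m + 1) = t := by
      simp only [q, hgm]; rw [min_eq_right ht.2, max_eq_right hst]
    rwa [e0, e1] at this
  -- Additivity fails only in a grid cell that `s` cuts. Charging one defect to each of the m+1
  -- cells is wasteful, but the total still tends to 0 because θ > 1.
  have hadd : ∀ m, ∀ s ∈ Set.Icc 0 T, ∀ t ∈ Set.Icc 0 T, s ≤ t →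
      ‖J m 0 t - J m 0 s - J m s t‖ ≤ (m + 1) * (C * (T / (m + 1)) ^ θ) := by
    intro m s hs t ht hst
    simp only [J, ← Finset.sum_sub_distrib]
    refine (norm_sum_le _ _).trans ?_
    have : ((m : ℝ) + 1) * (C * (T / (m + 1)) ^ θ)
        = ∑ k ∈ Finset.range (m + 1), C * (T / (m + 1)) ^ θ := by simp
    rw [this]
    refine Finset.sum_le_sum fun k _ => ?_
    have hnn : 0 ≤ C * (T / (m + 1)) ^ θ := by positivity
    have hk := hgs m k
    have hk0 := hgnn m k
    have hstep : g m k ≤ g m (k + 1) := hg m (Nat.le_succ _)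
    have hz : ∀ x : ℝ, 0 ≤ x → max 0 x = x := fun x hx => max_eq_right hx
    have e : ∀ r, 0 ≤ r → ∀ k, q m 0 r k = min (g m k) r := fun r hr k =>
      hz _ (le_min (hgnn m k) hr)
    rw [e t ht.1, e t ht.1, e s hs.1, e s hs.1]
    simp only [q]
    rcases le_total (g m (k + 1)) s with h | h
    · have h' := hstep.trans h
      rw [min_eq_left (h.trans hst), min_eq_left (h'.trans hst), min_eq_left h, min_eq_left h',
        max_eq_left h, max_eq_left h', hΞ₀ s hs]
      simpa using hnn
    rcases le_total s (g m k) with h' | h'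
    · rw [min_eq_right h, min_eq_right h', max_eq_right (le_min h' hst),
        max_eq_right (le_min h hst), hΞ₀ s hs]
      simpa using hnn
    · rw [min_eq_left h', min_eq_left (h'.trans hst), min_eq_right h, max_eq_left h',
        max_eq_right (le_min h hst)]
      have hs' : s ≤ min (g m (k + 1)) t := le_min h hst
      refine (hΞ _ ⟨hk0, h'.trans hs.2⟩ _ hs _ ⟨hs.1.trans hs', (min_le_right _ _).trans ht.2⟩
        h' hs').trans ?_
      have : min (g m (k + 1)) t - g m k ≤ T / (m + 1) := by
        rw [← hk]; linarith [min_le_left (g m (k + 1)) t]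
      have : 0 ≤ min (g m (k + 1)) t - g m k := by linarith
      gcongr
  have hlim : Tendsto (fun m : ℕ => ((m : ℝ) + 1) * (C * (T / (m + 1)) ^ θ)) atTop (𝓝 0) := by
    have h1 : Tendsto (fun m : ℕ => ((m : ℝ) + 1) ^ (-(θ - 1))) atTop (𝓝 0) :=
      (tendsto_rpow_neg_atTop (by linarith)).comp
        (tendsto_atTop_add_const_right _ _ tendsto_natCast_atTop_atTop)
    have h2 := h1.const_mul (C * T ^ θ)
    rw [mul_zero] at h2
    refine h2.congr fun m => ?_
    have hm : (0 : ℝ) < m + 1 := by positivity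
    rw [Real.div_rpow hT.le hm.le, neg_sub, Real.rpow_sub hm, Real.rpow_one]
    field_simp
  -- The maximal inequality keeps the sums in a compact ball, so they converge for every `t` along
  -- one fixed ultrafilter, and no Cauchy estimate between grids is needed.
  let U : Ultrafilter ℕ := hyperfilter ℕ
  have hU : (U : Filter ℕ) ≤ atTop := Nat.hyperfilter_le_atTop
  have hconv : ∀ t ∈ Set.Icc 0 T, ∃ y, Tendsto (fun m => J m 0 t) U (𝓝 y) := by
    intro t ht
    have hb : ∀ m, J m 0 t ∈ Metric.closedBall (Ξ 0 t) (K * (t - 0) ^ θ) := fun m => by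
      rw [Metric.mem_closedBall, dist_eq_norm]
      exact hJ m 0 ⟨le_rfl, hT.le⟩ t ht ht.1
    obtain ⟨y, -, hy⟩ := (isCompact_closedBall (Ξ 0 t) (K * (t - 0) ^ θ)).ultrafilter_le_nhds
      (U.map fun m => J m 0 t) (tendsto_principal.2 (Filter.Eventually.of_forall hb))
    exact ⟨y, hy⟩
  choose! I hI using hconv
  have hest : ∀ s ∈ Set.Icc 0 T, ∀ t ∈ Set.Icc 0 T, s ≤ t →
      ‖I t - I s - Ξ s t‖ ≤ K * (t - s) ^ θ := by
    intro s hs t ht hst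
    have h1 : Tendsto (fun m => ‖J m 0 t - J m 0 s - Ξ s t‖) U (𝓝 ‖I t - I s - Ξ s t‖) :=
      (((hI t ht).sub (hI s hs)).sub_const _).norm
    have h2 : Tendsto (fun m : ℕ => ((m : ℝ) + 1) * (C * (T / (m + 1)) ^ θ) + K * (t - s) ^ θ) U
        (𝓝 (0 + K * (t - s) ^ θ)) := (hlim.mono_left hU).add_const _
    rw [zero_add] at h2
    refine le_of_tendsto_of_tendsto' h1 h2 fun m => ?_
    have : J m 0 t - J m 0 s - Ξ s t
        = (J m 0 t - J m 0 s - J m s t) + (J m s t - Ξ s t) := by abel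
    rw [this]
    exact (norm_add_le _ _).trans (add_le_add (hadd m s hs t ht hst) (hJ m s hs t ht hst))
  refine ⟨fun t => I t - I 0, K, hK0, sub_self _, fun s hs t ht hst => ?_⟩
  simpa using hest s hs t ht hst

/-- A function whose increments are approximated by `Ξ` is the limit of the sums of `Ξ`. -/
theorem isRiemannLimit_of_estimate {Ξ : ℝ → ℝ → E} {I : ℝ → E} {T K θ : ℝ} (hK : 0 ≤ K)
    (hθ : 1 < θ) (hI₀ : I 0 = 0)
    (hI : ∀ s ∈ Set.Icc 0 T, ∀ t ∈ Set.Icc 0 T, s ≤ t →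
      ‖I t - I s - Ξ s t‖ ≤ K * (t - s) ^ θ) {t : ℝ} (ht : t ∈ Set.Icc 0 T) :
    IsRiemannLimit Ξ 0 t (I t) := by
  intro ε hε
  have hlim : Tendsto (fun δ : ℝ => K * δ ^ (θ - 1) * t) (𝓝[>] 0) (𝓝 0) := by
    have h1 : Tendsto (fun δ : ℝ => δ ^ (θ - 1)) (𝓝[>] 0) (𝓝 0) := by
      have := (Real.continuousAt_rpow_const 0 (θ - 1) (Or.inr (by linarith))).tendsto
      rw [Real.zero_rpow (by linarith)] at this
      exact this.mono_left nhdsWithin_le_nhds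
    have h2 := (h1.const_mul K).mul_const t
    simpa using h2
  obtain ⟨δ, hδε, hδ⟩ := ((hlim.eventually (gt_mem_nhds hε)).and self_mem_nhdsWithin).exists
  refine ⟨δ, hδ, fun m p hp0 hpm hp => ?_⟩
  have hmono : ∀ i ≤ m, ∀ j ≤ i, p j ≤ p i := by
    intro i
    induction i with
    | zero => intro _ j hj; rw [Nat.le_zero.1 hj]
    | succ i ih =>
      intro him j hj
      rcases hj.lt_or_eq with h | h
      · exact (ih (by omega) j (by omega)).trans (hp i (by omega)).1.le
      · rw [h]
  have hmem : ∀ i ≤ m, p i ∈ Set.Icc 0 T := fun i hi =>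
    ⟨hp0 ▸ hmono i hi 0 (Nat.zero_le _), (hmono m le_rfl i hi).trans (hpm ▸ ht.2)⟩
  have htel : I t = ∑ k ∈ Finset.range m, (I (p (k + 1)) - I (p k)) := by
    rw [Finset.sum_range_sub (fun k => I (p k)), hpm, hp0, hI₀, sub_zero]
  have htel' : t = ∑ k ∈ Finset.range m, (p (k + 1) - p k) := by
    rw [Finset.sum_range_sub, hpm, hp0, sub_zero]
  refine lt_of_le_of_lt ?_ hδε
  rw [htel, ← Finset.sum_sub_distrib]
  refine (norm_sum_le _ _).trans ?_
  conv_rhs => rw [htel', Finset.mul_sum]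
  refine Finset.sum_le_sum fun k hk => ?_
  rw [Finset.mem_range] at hk
  obtain ⟨hk1, hk2⟩ := hp k hk
  have hpos : 0 < p (k + 1) - p k := sub_pos.2 hk1
  rw [norm_sub_rev]
  refine (hI _ (hmem k hk.le) _ (hmem _ hk) hk1.le).trans ?_
  have : (p (k + 1) - p k) ^ θ = (p (k + 1) - p k) ^ (θ - 1) * (p (k + 1) - p k) := by
    rw [← Real.rpow_add_one hpos.ne']; ring_nf
  rw [this, ← mul_assoc]
  have : 0 ≤ θ - 1 := by linarith
  gcongr

/-- A function with increments of order greater than one is constant. -/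
theorem eq_of_norm_sub_le_rpow {Z : ℝ → E} {T K θ : ℝ} (hK : 0 ≤ K) (hθ : 1 < θ)
    (hZ : ∀ s ∈ Set.Icc 0 T, ∀ t ∈ Set.Icc 0 T, s ≤ t → ‖Z t - Z s‖ ≤ K * (t - s) ^ θ)
    {t : ℝ} (ht : t ∈ Set.Icc 0 T) : Z t = Z 0 := by
  rcases ht.1.eq_or_lt with h | h
  · rw [← h]
  -- The increment of `Z` is a limit of Riemann sums of the zero germ; a fine uniform partition then
  -- shows that it vanishes.
  have hR := isRiemannLimit_of_estimate (Ξ := fun _ _ => (0 : E)) (I := fun t => Z t - Z 0)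
    hK hθ (sub_self _) (fun s hs t ht hst => by simpa using hZ s hs t ht hst) ht
  refine sub_eq_zero.1 (norm_le_zero_iff.1 (le_of_forall_pos_lt_add fun ε hε => ?_))
  obtain ⟨δ, hδ, H⟩ := hR ε hε
  obtain ⟨m, hm⟩ := exists_nat_gt (t / δ)
  have hm0 : (0 : ℝ) < m := lt_trans (by positivity) hm
  have := H m (fun k => t / m * k) (by simp) (by field_simp) (fun k _ => by
    have h1 : t / m * ((k + 1 : ℕ) : ℝ) - t / m * k = t / m := by push_cast; ring
    have h2 : 0 < t / m := by positivity
    have h3 : t / m < δ := by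
      rw [div_lt_iff₀ hδ] at hm
      rw [div_lt_iff₀ hm0]; linarith
    constructor
    · linarith
    · rw [h1]; exact h3)
  simpa [norm_sub_rev] using this

end Sewing

/-! ### Taylor estimates, uniform on balls. -/

section Taylor

variable {d : ℕ} {E : Type*} [NormedAddCommGroup E] [NormedSpace ℝ E]

theorem contDiff_pderiv {G : EuclideanSpace ℝ (Fin d) → E} (hG : ContDiff ℝ ∞ G) (i : Fin d) :
    ContDiff ℝ ∞ (pderiv i G) :=
  (hG.fderiv_right (m := ∞) (by simp)).clm_apply contDiff_const

theorem pderiv_comm {G : EuclideanSpace ℝ (Fin d) → E} (hG : ContDiff ℝ ∞ G) (i j : Fin d) :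
    pderiv i (pderiv j G) = pderiv j (pderiv i G) := by
  have key : ∀ (x : EuclideanSpace ℝ (Fin d)) (a b : Fin d), pderiv a (pderiv b G) x
      = fderiv ℝ (fderiv ℝ G) x (EuclideanSpace.single a 1) (EuclideanSpace.single b 1) := by
    intro x a b
    have hd : DifferentiableAt ℝ (fderiv ℝ G) x :=
      ((hG.fderiv_right (m := ∞) (by simp)).differentiable (by simp)) x
    have := (hd.hasFDerivAt.clm_apply (hasFDerivAt_const (EuclideanSpace.single b (1 : ℝ)) x)).fderiv
    change fderiv ℝ (fun y => fderiv ℝ G y (EuclideanSpace.single b 1)) x _ = _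
    rw [this]
    simp
  funext x
  rw [key, key]
  exact ((contDiff_infty.1 hG 2).contDiffAt.isSymmSndFDerivAt (by simp)).eq _ _

theorem hasDerivAt_comp_line {G : EuclideanSpace ℝ (Fin d) → E} (hG : ContDiff ℝ ∞ G)
    (x h : EuclideanSpace ℝ (Fin d)) (r : ℝ) :
    HasDerivAt (fun r : ℝ => G (x + r • h)) (∑ i, h i • pderiv i G (x + r • h)) r := by
  have h1 : HasDerivAt (fun r : ℝ => x + r • h) h r := by
    simpa using ((hasDerivAt_id r).smul_const h).const_add x
  have h2 := ((hG.differentiable (by simp)) (x + r • h)).hasFDerivAt.comp_hasDerivAt r h1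
  have h3 : fderiv ℝ G (x + r • h) h = ∑ i, h i • pderiv i G (x + r • h) := by
    generalize x + r • h = z
    conv_lhs => rw [← (EuclideanSpace.basisFun (Fin d) ℝ).sum_repr h, map_sum]
    simp [pderiv]
  rw [← h3]
  exact h2

/-- Mean value inequality on the unit interval. Having the bound at every `r`, and not only at 1,
lets it serve as a derivative bound for the next order. -/
theorem norm_sub_zero_le_of_deriv {f f' : ℝ → E} {M : ℝ} (hf : ∀ r, HasDerivAt f (f' r) r)
    (hM : ∀ r ∈ Set.Icc (0 : ℝ) 1, ‖f' r‖ ≤ M) : ∀ r ∈ Set.Icc (0 : ℝ) 1, ‖f r - f 0‖ ≤ M := by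
  intro r hr
  have h0 : (0 : ℝ) ∈ Set.Icc (0 : ℝ) 1 := by simp
  have h := (convex_Icc (0 : ℝ) 1).norm_image_sub_le_of_norm_hasDerivWithin_le
    (fun r _ => (hf r).hasDerivWithinAt) hM h0 hr
  refine h.trans (mul_le_of_le_one_right ((norm_nonneg _).trans (hM 0 h0)) ?_)
  rw [sub_zero, Real.norm_eq_abs, abs_of_nonneg hr.1]
  exact hr.2

theorem norm_sum_coord_smul_le (h : EuclideanSpace ℝ (Fin d)) (a : Fin d → E) {M : ℝ}
    (ha : ∀ i, ‖a i‖ ≤ M) : ‖∑ i, h i • a i‖ ≤ d * ‖h‖ * M := by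
  refine (norm_sum_le _ _).trans ((Finset.sum_le_sum (g := fun _ => ‖h‖ * M) fun i _ => ?_).trans
    (le_of_eq ?_))
  · rw [norm_smul]
    exact mul_le_mul (PiLp.norm_apply_le h i) (ha i) (norm_nonneg _) (norm_nonneg _)
  · simp [mul_assoc]

theorem exists_bound_on_closedBall {d : ℕ} {E ι : Type*} [NormedAddCommGroup E] [Finite ι]
    {G : ι → EuclideanSpace ℝ (Fin d) → E}
    (hG : ∀ i, Continuous (G i)) (R : ℝ) :
    ∃ M, 0 ≤ M ∧ ∀ i, ∀ y ∈ Metric.closedBall 0 R, ‖G i y‖ ≤ M := by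
  cases nonempty_fintype ι
  obtain ⟨M, hM⟩ := (isCompact_closedBall (0 : EuclideanSpace ℝ (Fin d)) R).exists_bound_of_continuousOn
    (continuous_pi hG : Continuous fun y i => G i y).continuousOn
  exact ⟨max M 0, le_max_right _ _, fun i y hy =>
    (norm_le_pi_norm (fun i => G i y) i).trans ((hM y hy).trans (le_max_left _ _))⟩

theorem line_mem_closedBall {x y : EuclideanSpace ℝ (Fin d)} {R : ℝ}
    (hx : x ∈ Metric.closedBall 0 R) (hy : y ∈ Metric.closedBall 0 R) {r : ℝ}
    (hr : r ∈ Set.Icc (0 : ℝ) 1) : x + r • (y - x) ∈ Metric.closedBall 0 R := by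
  have := (convex_closedBall (0 : EuclideanSpace ℝ (Fin d)) R).add_smul_sub_mem hx hy hr
  exact this

theorem exists_taylor_zero {G : EuclideanSpace ℝ (Fin d) → E} (hG : ContDiff ℝ ∞ G) (R : ℝ) :
    ∃ C, 0 ≤ C ∧ ∀ x ∈ Metric.closedBall 0 R,
    ∀ y ∈ Metric.closedBall 0 R, ‖G y - G x‖ ≤ C * ‖y - x‖ := by
  have c1 := contDiff_pderiv hG
  obtain ⟨M, hM0, hM⟩ := exists_bound_on_closedBall (fun i => (c1 i).continuous) R
  refine ⟨d * M, by positivity, fun x hx y hy => ?_⟩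
  have h1 := norm_sub_zero_le_of_deriv (hasDerivAt_comp_line hG x (y - x)) (fun r hr =>
    norm_sum_coord_smul_le _ _ fun i => hM i _ (line_mem_closedBall hx hy hr))
    1 (by simp)
  simp only [one_smul, zero_smul, add_zero, add_sub_cancel] at h1
  refine h1.trans (le_of_eq (by ring))

theorem exists_taylor_one {G : EuclideanSpace ℝ (Fin d) → E} (hG : ContDiff ℝ ∞ G) (R : ℝ) :
    ∃ C, 0 ≤ C ∧ ∀ x ∈ Metric.closedBall 0 R,
    ∀ y ∈ Metric.closedBall 0 R,
    ‖G y - G x - ∑ i, (y - x) i • pderiv i G x‖ ≤ C * ‖y - x‖ ^ 2 := by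
  have c1 := contDiff_pderiv hG
  have c2 := fun i => contDiff_pderiv (c1 i)
  obtain ⟨M, hM0, hM⟩ := exists_bound_on_closedBall
    (G := fun p : Fin d × Fin d => pderiv p.2 (pderiv p.1 G)) (fun p => (c2 _ _).continuous) R
  refine ⟨d ^ 2 * M, by positivity, fun x hx y hy => ?_⟩
  set h := y - x with hh
  have hline : ∀ r ∈ Set.Icc (0 : ℝ) 1, x + r • h ∈ Metric.closedBall 0 R :=
    fun r hr => line_mem_closedBall hx hy hr
  have d1 := fun r => HasDerivAt.fun_sum (u := Finset.univ) fun i _ =>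
    (hasDerivAt_comp_line (c1 i) x h r).const_smul (h i)
  have b1 := norm_sub_zero_le_of_deriv d1 (fun r hr =>
    norm_sum_coord_smul_le h _ fun i => norm_sum_coord_smul_le h _ fun j =>
      hM (i, j) _ (hline r hr))
  have d0 := fun r => (hasDerivAt_comp_line hG x h r).sub
    ((hasDerivAt_id r).smul_const (∑ i, h i • pderiv i G x))
  have b0 := norm_sub_zero_le_of_deriv d0 (M := d * ‖h‖ * (d * ‖h‖ * M))
    (fun r hr => by simpa using b1 r hr) 1 (by simp)
  have e : x + h = y := by simp [hh]
  simp only [Pi.sub_apply, id_eq, one_smul, zero_smul, add_zero, sub_zero, e] at b0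
  rw [sub_right_comm] at b0
  refine b0.trans (le_of_eq (by ring))

/-- Along the segment from x to y, the derivative of the remainder of G is the sum of h_i times the
remainder of ∂_i G of one order less. The previous estimate and the mean value inequality then gain
one power of the norm of h. The third order is obtained in the same way. -/
theorem exists_taylor_two {G : EuclideanSpace ℝ (Fin d) → E} (hG : ContDiff ℝ ∞ G) (R : ℝ) :
    ∃ C, 0 ≤ C ∧ ∀ x ∈ Metric.closedBall 0 R,
    ∀ y ∈ Metric.closedBall 0 R,
    ‖G y - G x - ∑ i, (y - x) i • pderiv i G x
      - (1 / 2 : ℝ) • ∑ i, (y - x) i • ∑ j, (y - x) j • pderiv j (pderiv i G) x‖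
      ≤ C * ‖y - x‖ ^ 3 := by
  have c1 := contDiff_pderiv hG
  have h1 : ∀ i, ∃ C, 0 ≤ C ∧ ∀ x ∈ Metric.closedBall 0 R, ∀ y ∈ Metric.closedBall 0 R,
      ‖pderiv i G y - pderiv i G x - ∑ j, (y - x) j • pderiv j (pderiv i G) x‖
        ≤ C * ‖y - x‖ ^ 2 := fun i => exists_taylor_one (c1 i) R
  choose C hC0 hC using h1
  refine ⟨d * ∑ i, C i, mul_nonneg (by positivity) (Finset.sum_nonneg fun i _ => hC0 i), fun x hx y hy => ?_⟩
  set h := y - x with hh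
  have hline : ∀ r ∈ Set.Icc (0 : ℝ) 1, x + r • h ∈ Metric.closedBall 0 R :=
    fun r hr => line_mem_closedBall hx hy hr
  have hCi : ∀ i, C i ≤ ∑ i, C i := fun i =>
    Finset.single_le_sum (fun i _ => hC0 i) (Finset.mem_univ i)
  have d0 := fun r : ℝ => ((hasDerivAt_comp_line hG x h r).sub
    ((hasDerivAt_id r).smul_const (∑ i, h i • pderiv i G x))).sub
    (((hasDerivAt_pow 2 r).const_mul (1 / 2 : ℝ)).smul_const
      (∑ i, h i • ∑ j, h j • pderiv j (pderiv i G) x))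
  have b0 := norm_sub_zero_le_of_deriv d0 (M := d * ‖h‖ * ((∑ i, C i) * ‖h‖ ^ 2))
    (fun r hr => by
      have hb := norm_sum_coord_smul_le h (fun i => pderiv i G (x + r • h) - pderiv i G x
        - ∑ j, (x + r • h - x) j • pderiv j (pderiv i G) x) (M := (∑ i, C i) * ‖h‖ ^ 2) (fun i => by
          refine (hC i x hx _ (hline r hr)).trans ?_
          have : ‖x + r • h - x‖ ≤ ‖h‖ := by
            rw [add_sub_cancel_left, norm_smul, Real.norm_eq_abs, abs_of_nonneg hr.1]
            exact mul_le_of_le_one_left (norm_nonneg _) hr.2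
          have := (hC0 i).trans (hCi i)
          have := hCi i
          gcongr)
      refine le_trans (le_of_eq (congrArg _ ?_)) hb
      simp only [smul_sub, Finset.sum_sub_distrib, add_sub_cancel_left, PiLp.smul_apply,
        smul_eq_mul, Finset.smul_sum, smul_smul]
      norm_num
      refine Finset.sum_congr rfl fun i _ => Finset.sum_congr rfl fun j _ => ?_
      congr 1
      ring) 1 (by simp)
  have e : x + h = y := by simp [hh]
  simp only [Pi.sub_apply, id_eq, one_smul, zero_smul, add_zero, sub_zero, e] at b0
  refine le_trans (le_of_eq (congrArg _ ?_)) (b0.trans (le_of_eq (by ring)))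
  norm_num
  abel

theorem exists_taylor_three {G : EuclideanSpace ℝ (Fin d) → E} (hG : ContDiff ℝ ∞ G) (R : ℝ) :
    ∃ C, 0 ≤ C ∧ ∀ x ∈ Metric.closedBall 0 R,
    ∀ y ∈ Metric.closedBall 0 R,
    ‖G y - G x - ∑ i, (y - x) i • pderiv i G x
      - (1 / 2 : ℝ) • ∑ i, (y - x) i • ∑ j, (y - x) j • pderiv j (pderiv i G) x
      - (1 / 6 : ℝ) • ∑ i, (y - x) i • ∑ j, (y - x) j • ∑ k, (y - x) k •
        pderiv k (pderiv j (pderiv i G)) x‖ ≤ C * ‖y - x‖ ^ 4 := by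
  have c1 := contDiff_pderiv hG
  have h1 : ∀ i, ∃ C, 0 ≤ C ∧ ∀ x ∈ Metric.closedBall 0 R, ∀ y ∈ Metric.closedBall 0 R,
      ‖pderiv i G y - pderiv i G x - ∑ j, (y - x) j • pderiv j (pderiv i G) x
        - (1 / 2 : ℝ) • ∑ j, (y - x) j • ∑ k, (y - x) k • pderiv k (pderiv j (pderiv i G)) x‖
        ≤ C * ‖y - x‖ ^ 3 := fun i => exists_taylor_two (c1 i) R
  choose C hC0 hC using h1
  refine ⟨d * ∑ i, C i, mul_nonneg (by positivity) (Finset.sum_nonneg fun i _ => hC0 i), fun x hx y hy => ?_⟩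
  set h := y - x with hh
  have hline : ∀ r ∈ Set.Icc (0 : ℝ) 1, x + r • h ∈ Metric.closedBall 0 R :=
    fun r hr => line_mem_closedBall hx hy hr
  have hCi : ∀ i, C i ≤ ∑ i, C i := fun i =>
    Finset.single_le_sum (fun i _ => hC0 i) (Finset.mem_univ i)
  have d0 := fun r : ℝ => (((hasDerivAt_comp_line hG x h r).sub
    ((hasDerivAt_id r).smul_const (∑ i, h i • pderiv i G x))).sub
    (((hasDerivAt_pow 2 r).const_mul (1 / 2 : ℝ)).smul_const
      (∑ i, h i • ∑ j, h j • pderiv j (pderiv i G) x))).sub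
    (((hasDerivAt_pow 3 r).const_mul (1 / 6 : ℝ)).smul_const
      (∑ i, h i • ∑ j, h j • ∑ k, h k • pderiv k (pderiv j (pderiv i G)) x))
  have b0 := norm_sub_zero_le_of_deriv d0 (M := d * ‖h‖ * ((∑ i, C i) * ‖h‖ ^ 3))
    (fun r hr => by
      have hb := norm_sum_coord_smul_le h (fun i => pderiv i G (x + r • h) - pderiv i G x
        - ∑ j, (x + r • h - x) j • pderiv j (pderiv i G) x
        - (1 / 2 : ℝ) • ∑ j, (x + r • h - x) j • ∑ k, (x + r • h - x) k •
          pderiv k (pderiv j (pderiv i G)) x) (M := (∑ i, C i) * ‖h‖ ^ 3) (fun i => by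
          refine (hC i x hx _ (hline r hr)).trans ?_
          have : ‖x + r • h - x‖ ≤ ‖h‖ := by
            rw [add_sub_cancel_left, norm_smul, Real.norm_eq_abs, abs_of_nonneg hr.1]
            exact mul_le_of_le_one_left (norm_nonneg _) hr.2
          have := (hC0 i).trans (hCi i)
          have := hCi i
          gcongr)
      refine le_trans (le_of_eq (congrArg _ ?_)) hb
      simp only [smul_sub, Finset.sum_sub_distrib, add_sub_cancel_left, PiLp.smul_apply,
        smul_eq_mul, Finset.smul_sum, smul_smul]
      norm_num
      congr 1
      · congr 1
        refine Finset.sum_congr rfl fun i _ => Finset.sum_congr rfl fun j _ => ?_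
        congr 1
        ring
      · refine Finset.sum_congr rfl fun i _ => Finset.sum_congr rfl fun j _ =>
          Finset.sum_congr rfl fun k _ => ?_
        congr 1
        ring) 1 (by simp)
  have e : x + h = y := by simp [hh]
  simp only [Pi.sub_apply, id_eq, one_smul, zero_smul, add_zero, sub_zero, e] at b0
  refine le_trans (le_of_eq (congrArg _ ?_)) (b0.trans (le_of_eq (by ring)))
  norm_num
  abel

end Taylor

open PForest

/-! ### Coproducts and shuffles of small forests. -/

section Algebra

variable {B : Type*} (x y : PForest B → ℝ) (a b c : B)

theorem star_nil : PForest.star x y nil = x nil * y nil := by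
  simp [PForest.star, coprod]

theorem star_dot : PForest.star x y (dot a) = x (dot a) * y nil + x nil * y (dot a) := by
  simp [PForest.star, coprod, shuffle, concat, graft, dot]

theorem star_graft_dot : PForest.star x y (graft b (dot a))
    = x (graft b (dot a)) * y nil + x (dot a) * y (dot b) + x nil * y (graft b (dot a)) := by
  simp [PForest.star, coprod, shuffle, concat, graft, dot]
  ring

theorem star_dot_dot : PForest.star x y (concat (dot a) (dot b))
    = x (concat (dot a) (dot b)) * y nil + x (dot a) * y (dot b)
      + x nil * y (concat (dot a) (dot b)) := by
  simp [PForest.star, coprod, shuffle, concat, graft, dot]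
  ring

/-- Left admissibility: a single branch can be cut only if it is the leftmost one, so there is no
term pruning `b` alone. -/
theorem star_graft_dot_dot : PForest.star x y (graft c (concat (dot a) (dot b)))
    = x (graft c (concat (dot a) (dot b))) * y nil + x (concat (dot a) (dot b)) * y (dot c)
      + x (dot a) * y (graft c (dot b)) + x nil * y (graft c (concat (dot a) (dot b))) := by
  simp [PForest.star, coprod, shuffle, concat, graft, dot]
  ring

theorem star_dot_dot_dot : PForest.star x y (concat (concat (dot a) (dot b)) (dot c))
    = x (concat (concat (dot a) (dot b)) (dot c)) * y nil + x (concat (dot a) (dot b)) * y (dot c)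
      + x (dot a) * y (concat (dot b) (dot c))
      + x nil * y (concat (concat (dot a) (dot b)) (dot c)) := by
  simp [PForest.star, coprod, shuffle, concat, graft, dot]
  ring

theorem sum_shuffle_dot_dot : ((shuffle (dot a) (dot b)).map x).sum
    = x (concat (dot a) (dot b)) + x (concat (dot b) (dot a)) := by
  simp [shuffle, concat, graft, dot]
  ring

theorem sum_shuffle_dot_dot_dot : ((shuffle (dot a) (concat (dot b) (dot c))).map x).sum
    = x (concat (concat (dot a) (dot b)) (dot c)) + x (concat (concat (dot b) (dot a)) (dot c))
      + x (concat (concat (dot b) (dot c)) (dot a)) := by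
  simp [shuffle, concat, graft, dot]
  ring

end Algebra

/-! ### Forests that support the lift of G(X). -/

section BulletForests

variable {B : Type*} {d : ℕ} (ι : Fin d → B)

/-- The forests `𝟏`, `•_i` and `•_i •_j` with decorations in the range of `ι`. -/
def bullets : Option (Fin d ⊕ Fin d × Fin d) → PForest B
  | none => nil
  | some (.inl i) => dot (ι i)
  | some (.inr p) => concat (dot (ι p.1)) (dot (ι p.2))

variable {ι}

theorem bullets_injective (hι : Function.Injective ι) : Function.Injective (bullets ι) := by
  rintro (_ | i | ⟨i, j⟩) (_ | i' | ⟨i', j'⟩) h <;>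
    simp_all [bullets, dot, graft, concat, hι.eq_iff]

theorem order_bullets_le (p : Option (Fin d ⊕ Fin d × Fin d)) : order (bullets ι p) ≤ 2 := by
  rcases p with _ | i | ⟨i, j⟩ <;> simp [bullets, dot, graft, concat, order]

theorem sum_forestsLE_two [Finite B] {M : Type*} [AddCommMonoid M] (hι : Function.Injective ι)
    (f : PForest B → M) (hf : ∀ σ ∉ Set.range (bullets ι), f σ = 0) :
    ∑ σ ∈ forestsLE B 2, f σ = f nil + ∑ i, f (dot (ι i))
      + ∑ i, ∑ j, f (concat (dot (ι i)) (dot (ι j))) := by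
  classical
  have h1 : ∑ σ ∈ forestsLE B 2, f σ = ∑ σ ∈ Finset.univ.image (bullets ι), f σ := by
    refine (Finset.sum_subset ?_ fun σ _ hσ => hf σ ?_).symm
    · intro σ hσ
      obtain ⟨p, -, rfl⟩ := Finset.mem_image.1 hσ
      simpa [forestsLE] using order_bullets_le p
    · rintro ⟨p, rfl⟩
      exact hσ (Finset.mem_image_of_mem _ (Finset.mem_univ _))
  rw [h1, Finset.sum_image (fun p _ q _ h => bullets_injective hι h), Fintype.sum_option,
    Fintype.sum_sum_type, Fintype.sum_prod_type, add_assoc]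
  rfl

end BulletForests

/-! ### Symmetrisation and the defect of a germ. -/

section Sums

variable {d : ℕ} {E : Type*} [AddCommGroup E] [Module ℝ E]

/-- Against a symmetric tensor both terms of the shuffle relation contribute equally. -/
theorem sum_smul_eq_half {x₁ : Fin d → ℝ} {x₂ : Fin d → Fin d → ℝ} {f : Fin d → Fin d → E}
    (hx : ∀ i j, x₁ i * x₁ j = x₂ i j + x₂ j i) (hf : ∀ i j, f i j = f j i) :
    ∑ i, ∑ j, x₂ i j • f i j = (1 / 2 : ℝ) • ∑ i, x₁ i • ∑ j, x₁ j • f i j := by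
  have h1 : ∑ i, ∑ j, x₂ i j • f i j = ∑ i, ∑ j, x₂ j i • f i j := by
    rw [Finset.sum_comm]
    simp only [fun i j => hf j i]
  have h2 : ∑ i, x₁ i • ∑ j, x₁ j • f i j
      = ∑ i, ∑ j, x₂ i j • f i j + ∑ i, ∑ j, x₂ i j • f i j := by
    conv_rhs => arg 2; rw [h1]
    simp only [Finset.smul_sum, smul_smul, hx, add_smul, Finset.sum_add_distrib]
  rw [h2]
  module

/-- The factor 6 is 2·3: two equal terms from shuffling the inner pair of letters, then three from
shuffling in the remaining one. -/
theorem sum_smul_eq_sixth {x₁ : Fin d → ℝ} {x₂ : Fin d → Fin d → ℝ}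
    {x₃ : Fin d → Fin d → Fin d → ℝ} {f : Fin d → Fin d → Fin d → E}
    (hx : ∀ i j, x₁ i * x₁ j = x₂ i j + x₂ j i)
    (hx' : ∀ i j k, x₁ i * x₂ j k = x₃ i j k + x₃ j i k + x₃ j k i)
    (hf : ∀ i j k, f i j k = f j i k) (hf' : ∀ i j k, f i j k = f i k j) :
    ∑ i, ∑ j, ∑ k, x₃ i j k • f i j k
      = (1 / 6 : ℝ) • ∑ i, x₁ i • ∑ j, x₁ j • ∑ k, x₁ k • f i j k := by
  set S := ∑ i, ∑ j, ∑ k, x₃ i j k • f i j k with hS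
  have h1 : ∑ i, ∑ j, ∑ k, x₃ j i k • f i j k = S := by
    rw [Finset.sum_comm, hS]
    simp only [fun i j k => hf j i k]
  have h2 : ∑ i, ∑ j, ∑ k, x₃ j k i • f i j k = S := by
    rw [Finset.sum_comm, hS]
    refine Finset.sum_congr rfl fun j _ => ?_
    rw [Finset.sum_comm]
    refine Finset.sum_congr rfl fun k _ => Finset.sum_congr rfl fun i _ => ?_
    rw [hf, hf']
  have h3 : ∑ i, x₁ i • ∑ j, x₁ j • ∑ k, x₁ k • f i j k = (2 : ℝ) • (S + S + S) := by
    have : ∀ i, ∑ j, x₁ j • ∑ k, x₁ k • f i j k = (2 : ℝ) • ∑ j, ∑ k, x₂ j k • f i j k := by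
      intro i
      rw [sum_smul_eq_half hx (hf' i), smul_smul]
      norm_num
    simp only [this, smul_comm _ (2 : ℝ), ← Finset.smul_sum]
    congr 1
    conv_rhs => arg 1; arg 2; rw [← h1]
    conv_rhs => arg 2; rw [← h2]
    simp only [Finset.smul_sum, smul_smul, hx', add_smul, Finset.sum_add_distrib, hS]
  rw [h3]
  module

/-- Here `u` and `v` stand for the coordinates of [τ]_a over the two consecutive intervals, and
`x₁`, `x₂` for those of the bullet forests over the first. The cross terms of Chen's relation
complete the increments of the integrand to controlled remainders. -/
theorem germ_defect (x₁ : Fin d → ℝ) (x₂ : Fin d → Fin d → ℝ) (u₀ v₀ : ℝ) (u₁ v₁ : Fin d → ℝ)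
    (u₂ v₂ : Fin d → Fin d → ℝ) (g₀ g₀' : E) (g₁ g₁' : Fin d → E) (g₂ g₂' : Fin d → Fin d → E) :
    ((u₀ + v₀) • g₀ + ∑ i, (u₁ i + x₁ i * v₀ + v₁ i) • g₁ i
        + ∑ i, ∑ j, (u₂ i j + x₂ i j * v₀ + x₁ i * v₁ j + v₂ i j) • g₂ i j)
      - (u₀ • g₀ + ∑ i, u₁ i • g₁ i + ∑ i, ∑ j, u₂ i j • g₂ i j)
      - (v₀ • g₀' + ∑ i, v₁ i • g₁' i + ∑ i, ∑ j, v₂ i j • g₂' i j)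
    = -(v₀ • (g₀' - g₀ - ∑ i, x₁ i • g₁ i - ∑ i, ∑ j, x₂ i j • g₂ i j)
        + ∑ j, v₁ j • (g₁' j - g₁ j - ∑ i, x₁ i • g₂ i j)
        + ∑ i, ∑ j, v₂ i j • (g₂' i j - g₂ i j)) := by
  have h : ∑ j, v₁ j • ∑ i, x₁ i • g₂ i j = ∑ i, ∑ j, (x₁ i * v₁ j) • g₂ i j := by
    rw [Finset.sum_comm]
    simp only [Finset.smul_sum, smul_smul, mul_comm]
  have h1 : v₀ • ∑ i, x₁ i • g₁ i = ∑ i, (x₁ i * v₀) • g₁ i := by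
    simp only [Finset.smul_sum, smul_smul, mul_comm]
  have h2 : v₀ • ∑ i, ∑ j, x₂ i j • g₂ i j = ∑ i, ∑ j, (x₂ i j * v₀) • g₂ i j := by
    simp only [Finset.smul_sum, smul_smul, mul_comm]
  simp only [add_smul, smul_sub, Finset.sum_add_distrib, Finset.sum_sub_distrib, h, h1, h2]
  abel

end Sums

/-! ### Orders of magnitude in powers of α. -/

section Small

variable {E : Type*} [NormedAddCommGroup E] {α T : ℝ} {k l : ℕ}

/-- `f s u t` is of order `k α` in the distances between `s`, `u` and `t`, uniformly on `[0,T]`. -/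
def Small (α T : ℝ) (k : ℕ) (f : ℝ → ℝ → ℝ → E) : Prop :=
  ∃ C, 0 ≤ C ∧ ∀ s ∈ Set.Icc 0 T, ∀ u ∈ Set.Icc 0 T, ∀ t ∈ Set.Icc 0 T, ∀ r,
    |u - s| ≤ r → |t - u| ≤ r → ‖f s u t‖ ≤ C * (r ^ α) ^ k

theorem Small.congr {f g : ℝ → ℝ → ℝ → E} (hf : Small α T k f)
    (h : ∀ s ∈ Set.Icc 0 T, ∀ u ∈ Set.Icc 0 T, ∀ t ∈ Set.Icc 0 T, g s u t = f s u t) :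
    Small α T k g := by
  obtain ⟨C, hC, H⟩ := hf
  refine ⟨C, hC, fun s hs u hu t ht r h1 h2 => ?_⟩
  rw [h s hs u hu t ht]
  exact H s hs u hu t ht r h1 h2

theorem Small.add {f g : ℝ → ℝ → ℝ → E} (hf : Small α T k f) (hg : Small α T k g) :
    Small α T k (fun s u t => f s u t + g s u t) := by
  obtain ⟨C, hC, H⟩ := hf
  obtain ⟨C', hC', H'⟩ := hg
  refine ⟨C + C', by positivity, fun s hs u hu t ht r h1 h2 => ?_⟩
  rw [add_mul]
  exact (norm_add_le _ _).trans
    (add_le_add (H s hs u hu t ht r h1 h2) (H' s hs u hu t ht r h1 h2))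

theorem Small.neg {f : ℝ → ℝ → ℝ → E} (hf : Small α T k f) :
    Small α T k (fun s u t => -f s u t) := by
  simpa only [Small, norm_neg] using hf

theorem Small.sub {f g : ℝ → ℝ → ℝ → E} (hf : Small α T k f) (hg : Small α T k g) :
    Small α T k (fun s u t => f s u t - g s u t) := by
  simpa only [sub_eq_add_neg] using hf.add hg.neg

theorem Small.zero : Small α T k (fun _ _ _ => (0 : E)) :=
  ⟨0, le_rfl, by simp⟩

theorem Small.sum {ι : Type*} (S : Finset ι) {f : ι → ℝ → ℝ → ℝ → E}
    (hf : ∀ i, Small α T k (f i)) : Small α T k (fun s u t => ∑ i ∈ S, f i s u t) := by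
  classical
  induction S using Finset.induction_on with
  | empty => simpa using Small.zero
  | insert i S hi ih => simpa only [Finset.sum_insert hi] using (hf i).add ih

theorem Small.smul [NormedSpace ℝ E] {c : ℝ → ℝ → ℝ → ℝ} {f : ℝ → ℝ → ℝ → E} (hc : Small α T k c)
    (hf : Small α T l f) : Small α T (k + l) (fun s u t => c s u t • f s u t) := by
  obtain ⟨C, hC, H⟩ := hc
  obtain ⟨C', hC', H'⟩ := hf
  refine ⟨C * C', by positivity, fun s hs u hu t ht r h1 h2 => ?_⟩
  have hr : 0 ≤ r := (abs_nonneg _).trans h1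
  rw [norm_smul, pow_add, mul_mul_mul_comm]
  exact mul_le_mul (H s hs u hu t ht r h1 h2) (H' s hs u hu t ht r h1 h2) (norm_nonneg _)
    (by positivity)

theorem Small.of_norm_le_pow {F : Type*} [NormedAddCommGroup F] {v : ℝ → ℝ → ℝ → F}
    {f : ℝ → ℝ → ℝ → E} (hv : Small α T 1 v) {C : ℝ} (hC : 0 ≤ C)
    (h : ∀ s ∈ Set.Icc 0 T, ∀ u ∈ Set.Icc 0 T, ∀ t ∈ Set.Icc 0 T,
      ‖f s u t‖ ≤ C * ‖v s u t‖ ^ k) : Small α T k f := by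
  obtain ⟨C', hC', H⟩ := hv
  refine ⟨C * C' ^ k, by positivity, fun s hs u hu t ht r h1 h2 => ?_⟩
  refine (h s hs u hu t ht).trans ?_
  rw [mul_assoc, ← mul_pow]
  have := H s hs u hu t ht r h1 h2
  rw [pow_one] at this
  gcongr

/-- The common bound `r` on both distances is what allows estimates over [s,u] and over [u,t] to be
multiplied. -/
theorem Small.comp_right {f : ℝ → ℝ → E} (hf : Small α T k (fun s u _ => f s u)) :
    Small α T k (fun _ u t => f u t) := by
  obtain ⟨C, hC, H⟩ := hf
  exact ⟨C, hC, fun s _ u hu t ht r _ h2 => H u hu t ht t ht r h2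
    (by simpa using (abs_nonneg _).trans h2)⟩

theorem Small.norm_le {f : ℝ → ℝ → E} (hf : Small α T k (fun s u _ => f s u)) :
    ∃ C, 0 ≤ C ∧ ∀ s ∈ Set.Icc 0 T, ∀ t ∈ Set.Icc 0 T, ‖f s t‖ ≤ C * |t - s| ^ ((k : ℝ) * α) := by
  obtain ⟨C, hC, H⟩ := hf
  refine ⟨C, hC, fun s hs t ht => ?_⟩
  rw [mul_comm (k : ℝ), Real.rpow_mul_natCast (abs_nonneg _)]
  exact H s hs t ht t ht _ le_rfl (by simp)

theorem small_of_norm_le {f : ℝ → ℝ → E} {C : ℝ} (hC : 0 ≤ C) (hα : 0 ≤ α)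
    (h : ∀ s ∈ Set.Icc 0 T, ∀ t ∈ Set.Icc 0 T, ‖f s t‖ ≤ C * |t - s| ^ ((k : ℝ) * α)) :
    Small α T k (fun s u _ => f s u) := by
  refine ⟨C, hC, fun s hs u hu t _ r h1 _ => ?_⟩
  have hr : 0 ≤ r := (abs_nonneg _).trans h1
  rw [← Real.rpow_mul_natCast hr, mul_comm α]
  exact (h s hs u hu).trans (by gcongr)

/-- The sewing lemma in the scale of powers of `α`. -/
theorem exists_sewing_of_small [ProperSpace E] {Ξ : ℝ → ℝ → E} (hT : 0 < T) (hα : 1 / 4 < α)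
    (hΞ₀ : ∀ s ∈ Set.Icc 0 T, Ξ s s = 0)
    (hΞ : Small α T 4 (fun s u t => Ξ s t - Ξ s u - Ξ u t)) :
    ∃ I : ℝ → E, (∀ t ∈ Set.Icc 0 T, IsRiemannLimit Ξ 0 t (I t)) ∧
      Small α T 4 (fun s t _ => I t - I s - Ξ s t) := by
  have hθ : 1 < ((4 : ℕ) : ℝ) * α := by push_cast; linarith
  obtain ⟨C, hC, H⟩ := hΞ
  have hle : ∀ s ∈ Set.Icc 0 T, ∀ u ∈ Set.Icc 0 T, ∀ t ∈ Set.Icc 0 T, ∀ r, |u - s| ≤ r →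
      |t - u| ≤ r → ‖Ξ s t - Ξ s u - Ξ u t‖ ≤ C * r ^ (((4 : ℕ) : ℝ) * α) := by
    intro s hs u hu t ht r h1 h2
    rw [mul_comm _ α, Real.rpow_mul_natCast ((abs_nonneg _).trans h1)]
    exact H s hs u hu t ht r h1 h2
  obtain ⟨I, K, hK, hI0, hI⟩ := exists_sewing hT hC hθ hΞ₀ (fun s hs u hu t ht hsu hut =>
    hle s hs u hu t ht (t - s) (by rw [abs_of_nonneg] <;> linarith)
      (by rw [abs_of_nonneg] <;> linarith))
  refine ⟨I, fun t ht => isRiemannLimit_of_estimate hK hθ hI0 hI ht,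
    small_of_norm_le (C := K + C) (by positivity) (by linarith) fun s hs t ht => ?_⟩
  have hp : 0 ≤ |t - s| ^ (((4 : ℕ) : ℝ) * α) := by positivity
  rcases le_total s t with h | h
  · refine (hI s hs t ht h).trans ?_
    rw [abs_of_nonneg (sub_nonneg.2 h)] at hp ⊢
    nlinarith
  -- Backward increments reduce to forward ones through the defect at the triple (s, t, s), which is
  -- why the defect is controlled for unordered times.
  · have e : I t - I s - Ξ s t = (Ξ s s - Ξ s t - Ξ t s) - (I s - I t - Ξ t s) := by
      rw [hΞ₀ s hs]; abel
    rw [e, add_mul, add_comm]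
    refine (norm_sub_le _ _).trans (add_le_add
      (hle s hs t ht s hs _ le_rfl (by rw [abs_sub_comm])) ?_)
    rw [abs_sub_comm, abs_of_nonneg (sub_nonneg.2 h)]
    exact hI t ht s hs h

end Small

/-! ### Chen's relation and Hölder bounds for rough paths above X. -/

section RoughAbove

variable {B : Type*} {d : ℕ}

/-- `Z` is a rough path over an alphabet containing the letters `ι i`, with positive weights, whose
increments along these letters are those of `X`. -/
structure IsRoughPathAbove (w : B → ℕ) (α T : ℝ) (ι : Fin d → B) (Z : ℝ → ℝ → PForest B → ℝ)
    (X : ℝ → EuclideanSpace ℝ (Fin d)) : Prop where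
  isRoughPath : IsRoughPath w α 3 T Z
  one_le_weight : ∀ b, 1 ≤ w b
  injective : Function.Injective ι
  increment : ∀ s ∈ Set.Icc 0 T, ∀ t ∈ Set.Icc 0 T, ∀ i, Z s t (dot (ι i)) = X t i - X s i

variable {w : B → ℕ} {α T : ℝ} {Z : ℝ → ℝ → PForest B → ℝ}

section Chen

variable (hZ : IsRoughPath w α 3 T Z) {s u t : ℝ} (hs : s ∈ Set.Icc 0 T) (hu : u ∈ Set.Icc 0 T)
  (ht : t ∈ Set.Icc 0 T) (a b c : B)
include hZ hs hu ht

theorem IsRoughPath.chen_dot : Z s t (dot a) = Z s u (dot a) + Z u t (dot a) := by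
  rw [← hZ.chen s hs u hu t ht _ (by simp [dot, graft, order]), star_dot, hZ.unit s hs u hu,
    hZ.unit u hu t ht]
  ring

theorem IsRoughPath.chen_graft_dot : Z s t (graft b (dot a))
    = Z s u (graft b (dot a)) + Z s u (dot a) * Z u t (dot b) + Z u t (graft b (dot a)) := by
  rw [← hZ.chen s hs u hu t ht _ (by simp [dot, graft, order]), star_graft_dot, hZ.unit s hs u hu,
    hZ.unit u hu t ht]
  ring

theorem IsRoughPath.chen_graft_dot_dot : Z s t (graft c (concat (dot a) (dot b)))
    = Z s u (graft c (concat (dot a) (dot b))) + Z s u (concat (dot a) (dot b)) * Z u t (dot c)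
      + Z s u (dot a) * Z u t (graft c (dot b)) + Z u t (graft c (concat (dot a) (dot b))) := by
  rw [← hZ.chen s hs u hu t ht _ (by simp [dot, graft, order, concat]), star_graft_dot_dot,
    hZ.unit s hs u hu, hZ.unit u hu t ht]
  ring

theorem IsRoughPath.chen_dot_dot_dot : Z s t (concat (concat (dot a) (dot b)) (dot c))
    = Z s u (concat (concat (dot a) (dot b)) (dot c))
      + Z s u (concat (dot a) (dot b)) * Z u t (dot c)
      + Z s u (dot a) * Z u t (concat (dot b) (dot c))
      + Z u t (concat (concat (dot a) (dot b)) (dot c)) := by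
  rw [← hZ.chen s hs u hu t ht _ (by simp [dot, graft, order, concat]), star_dot_dot_dot,
    hZ.unit s hs u hu, hZ.unit u hu t ht]
  ring

end Chen

section Diagonal

variable (hZ : IsRoughPath w α 3 T Z) {s : ℝ} (hs : s ∈ Set.Icc 0 T) (a b c : B)
include hZ hs

theorem IsRoughPath.diag_dot : Z s s (dot a) = 0 := by
  linarith [hZ.chen_dot hs hs hs a]

theorem IsRoughPath.diag_graft_dot : Z s s (graft b (dot a)) = 0 := by
  have := hZ.chen_graft_dot hs hs hs a b
  rw [hZ.diag_dot hs a] at this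
  linarith

theorem IsRoughPath.diag_graft_dot_dot : Z s s (graft c (concat (dot a) (dot b))) = 0 := by
  have := hZ.chen_graft_dot_dot hs hs hs a b c
  rw [hZ.diag_dot hs a, hZ.diag_dot hs c] at this
  linarith

theorem IsRoughPath.diag_dot_dot_dot :
    Z s s (concat (concat (dot a) (dot b)) (dot c)) = 0 := by
  have := hZ.chen_dot_dot_dot hs hs hs a b c
  rw [hZ.diag_dot hs a, hZ.diag_dot hs c] at this
  linarith

end Diagonal

/-- Weight beyond `k` is absorbed into a power of `T`. The diagonal is a separate hypothesis because
the Hölder bound only concerns s ≠ t. -/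
theorem IsRoughPath.small (hZ : IsRoughPath w α 3 T Z) (hα : 0 < α) {τ : PForest B}
    (hτ : order τ ≤ 3) {k : ℕ} (hk : k ≤ weight w τ)
    (h0 : ∀ s ∈ Set.Icc 0 T, Z s s τ = 0) : Small α T k (fun s u _ => Z s u τ) := by
  obtain ⟨C, hC⟩ := hZ.holder τ hτ
  by_cases hT : 0 ≤ T
  swap
  · exact ⟨0, le_rfl, fun s hs => absurd (hs.1.trans hs.2) hT⟩
  obtain ⟨m, hm⟩ := Nat.exists_eq_add_of_le hk
  refine small_of_norm_le (C := max C 0 * T ^ ((m : ℝ) * α)) (by positivity) hα.le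
    fun s hs t ht => ?_
  by_cases hst : s = t
  · subst hst
    rw [h0 s hs, norm_zero]
    positivity
  have hpos : 0 < |t - s| := abs_pos.2 (sub_ne_zero.2 (Ne.symm hst))
  have hle : |t - s| ≤ T := abs_le.2 ⟨by linarith [hs.2, ht.1], by linarith [ht.2, hs.1]⟩
  rw [Real.norm_eq_abs]
  refine (hC s hs t ht hst).trans ?_
  have e : |t - s| ^ ((weight w τ : ℝ) * α)
      = |t - s| ^ ((m : ℝ) * α) * |t - s| ^ ((k : ℝ) * α) := by
    rw [← Real.rpow_add hpos, hm]
    push_cast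
    ring_nf
  rw [e, mul_assoc]
  have : 0 ≤ (m : ℝ) * α := by positivity
  gcongr
  exact le_max_left _ _

end RoughAbove

/-! ### Dual basis functionals. -/

section Dual

variable {B : Type*} (a b c e : B)

theorem dual_self (τ : PForest B) : dual τ τ = 1 := by simp [dual]

theorem dual_of_ne {σ τ : PForest B} (h : σ ≠ τ) : dual τ σ = 0 := by simp [dual, h]

theorem dual_dot_dot [DecidableEq B] : dual (dot b) (dot a) = if a = b then 1 else 0 := by
  simp [dual, dot, graft]

theorem dual_concat_concat [DecidableEq B] :
    dual (concat (dot b) (dot c)) (concat (dot a) (dot e))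
      = if a = b then (if e = c then 1 else 0) else 0 := by
  simp [dual, dot, graft, concat, ite_and]

end Dual

/-! ### The lift of G(X) over either alphabet. -/

section Lift

variable {B : Type*} {d : ℕ} {E : Type*} [NormedAddCommGroup E] [NormedSpace ℝ E]

/-- `Y` has coordinates `G(X)`, `∂_i G(X)` and `∂_i ∂_j G(X)` on `𝟏`, `•_{ι i}` and
`•_{ι i} •_{ι j}`, and vanishes on all other forests. -/
structure IsLift (ι : Fin d → B) (G : EuclideanSpace ℝ (Fin d) → E)
    (X : ℝ → EuclideanSpace ℝ (Fin d)) (Y : ℝ → PForest B → E) : Prop where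
  support : ∀ t, ∀ σ ∉ Set.range (bullets ι), Y t σ = 0
  nil : ∀ t, Y t nil = G (X t)
  dot : ∀ t i, Y t (dot (ι i)) = pderiv i G (X t)
  dot_dot : ∀ t i j, Y t (concat (PForest.dot (ι i)) (PForest.dot (ι j)))
    = pderiv i (pderiv j G) (X t)

theorem isLift_lift (G : EuclideanSpace ℝ (Fin d) → E) (X : ℝ → EuclideanSpace ℝ (Fin d)) :
    IsLift id G X (lift G X) where
  support t σ hσ := by
    unfold lift
    split
    · exact absurd ⟨none, rfl⟩ hσ
    · exact absurd ⟨some (.inl _), rfl⟩ hσ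
    · exact absurd ⟨some (.inr (_, _)), rfl⟩ hσ
    · rfl
  nil t := rfl
  dot t i := rfl
  dot_dot t i j := rfl

theorem incl_injective : Function.Injective (incl (d := d)) := by
  intro σ
  induction σ with
  | nil => rintro (_ | ⟨φ, a, c⟩) h <;> simp_all [incl, PForest.map]
  | snoc φ a c ih₁ ih₂ =>
    rintro (_ | ⟨φ', a', c'⟩) h
    · simp [incl, PForest.map] at h
    · simp only [incl, PForest.map, snoc.injEq, Sum.inl.injEq] at h
      rw [ih₁ h.1, h.2.1, ih₂ h.2.2]

theorem isLift_extendByZero (G : EuclideanSpace ℝ (Fin d) → E)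
    (X : ℝ → EuclideanSpace ℝ (Fin d)) :
    IsLift (Sum.inl : Fin d → BracketAlphabet d) G X (extendByZero (lift G X)) where
  support t σ hσ := by
    by_cases h : ∃ τ, incl τ = σ
    · obtain ⟨τ, rfl⟩ := h
      rw [extendByZero, incl_injective.extend_apply]
      refine (isLift_lift G X).support t τ ?_
      rintro ⟨p, rfl⟩
      refine hσ ⟨p, ?_⟩
      rcases p with _ | i | ⟨i, j⟩ <;> rfl
    · exact Function.extend_apply' _ _ _ h
  nil t := incl_injective.extend_apply _ _ PForest.nil
  dot t i := incl_injective.extend_apply _ _ (PForest.dot i)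
  dot_dot t i j := incl_injective.extend_apply _ _ (concat (PForest.dot i) (PForest.dot j))

variable {ι : Fin d → B} {G : EuclideanSpace ℝ (Fin d) → E} {X : ℝ → EuclideanSpace ℝ (Fin d)}
  {Y : ℝ → PForest B → E}

theorem IsLift.germ_eq [Finite B] (hY : IsLift ι G X Y) (hι : Function.Injective ι)
    (Z : ℝ → ℝ → PForest B → ℝ) (a : B) (s t : ℝ) :
    germ 3 Z Y a s t = Z s t (PForest.dot a) • G (X s)
      + ∑ i, Z s t (graft a (PForest.dot (ι i))) • pderiv i G (X s)
      + ∑ i, ∑ j, Z s t (graft a (concat (PForest.dot (ι i)) (PForest.dot (ι j))))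
        • pderiv i (pderiv j G) (X s) := by
  have h := sum_forestsLE_two hι (fun τ => Z s t (graft a τ) • Y s τ)
    (fun σ hσ => by simp only [hY.support s σ hσ, smul_zero])
  simp only [hY.nil, hY.dot, hY.dot_dot] at h
  exact h

end Lift

/-! ### Controlledness and rough integrals of G(X). -/

section RoughAbove

variable {B : Type*} {d : ℕ} {w : B → ℕ} {α T : ℝ} {ι : Fin d → B} {Z : ℝ → ℝ → PForest B → ℝ}
  {X : ℝ → EuclideanSpace ℝ (Fin d)} {E : Type*} [NormedAddCommGroup E] [NormedSpace ℝ E]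
  {G : EuclideanSpace ℝ (Fin d) → E}

theorem IsRoughPathAbove.small_increment (H : IsRoughPathAbove w α T ι Z X) (hα : 0 < α) :
    Small α T 1 (fun s u _ => X u - X s) := by
  have h1 : ∀ i, Small α T 1 (fun s u _ => Z s u (dot (ι i))) := fun i =>
    H.isRoughPath.small hα (by simp [dot, graft, order])
      (by simpa [dot, graft, weight] using H.one_le_weight (ι i))
      (fun s hs => H.isRoughPath.diag_dot hs _)
  have h2 : ∀ i : Fin d, Small α T 0
      (fun _ _ _ => (EuclideanSpace.single i 1 : EuclideanSpace ℝ (Fin d))) := fun i =>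
    ⟨1, zero_le_one, by simp⟩
  refine (Small.sum Finset.univ fun i => (h1 i).smul (h2 i)).congr fun s hs u hu _ _ => ?_
  simp only [H.increment s hs u hu]
  ext j
  simp [Finset.sum_apply, Pi.single_apply]

theorem IsRoughPathAbove.exists_mem_closedBall (H : IsRoughPathAbove w α T ι Z X) (hα : 0 < α) :
    ∃ R, ∀ t ∈ Set.Icc 0 T, X t ∈ Metric.closedBall 0 R := by
  obtain ⟨C, hC, h⟩ := H.small_increment hα
  refine ⟨C * (T ^ α) ^ 1 + ‖X 0‖, fun t ht => ?_⟩
  have h0 : (0 : ℝ) ∈ Set.Icc 0 T := ⟨le_rfl, ht.1.trans ht.2⟩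
  have := h 0 h0 t ht t ht T (by rw [sub_zero, abs_of_nonneg ht.1]; exact ht.2)
    (by simpa using h0.2)
  rw [mem_closedBall_zero_iff]
  calc ‖X t‖ = ‖(X t - X 0) + X 0‖ := by rw [sub_add_cancel]
    _ ≤ _ := (norm_add_le _ _).trans (by gcongr)

theorem IsRoughPathAbove.small_comp {E : Type*} [NormedAddCommGroup E]
    {G : EuclideanSpace ℝ (Fin d) → E} (H : IsRoughPathAbove w α T ι Z X) (hα : 0 < α)
    (hG : Continuous G) : Small α T 0 (fun s _ _ => G (X s)) := by
  obtain ⟨R, hR⟩ := H.exists_mem_closedBall hα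
  obtain ⟨M, hM0, hM⟩ := exists_bound_on_closedBall (fun _ : Unit => hG) R
  exact ⟨M, hM0, fun s hs _ _ _ _ _ _ _ => by simpa using hM () _ (hR s hs)⟩

theorem IsRoughPathAbove.shuffle_dot_dot (H : IsRoughPathAbove w α T ι Z X) {s t : ℝ}
    (hs : s ∈ Set.Icc 0 T) (ht : t ∈ Set.Icc 0 T) (i j : Fin d) :
    (X t - X s) i * (X t - X s) j
      = Z s t (concat (dot (ι i)) (dot (ι j))) + Z s t (concat (dot (ι j)) (dot (ι i))) := by
  have := H.isRoughPath.mul s hs t ht (dot (ι i)) (dot (ι j)) (by simp [dot, graft, order])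
  rw [sum_shuffle_dot_dot, H.increment s hs t ht, H.increment s hs t ht] at this
  exact this.symm

theorem IsRoughPathAbove.shuffle_dot_dot_dot (H : IsRoughPathAbove w α T ι Z X) {s t : ℝ}
    (hs : s ∈ Set.Icc 0 T) (ht : t ∈ Set.Icc 0 T) (i j k : Fin d) :
    (X t - X s) i * Z s t (concat (dot (ι j)) (dot (ι k)))
      = Z s t (concat (concat (dot (ι i)) (dot (ι j))) (dot (ι k)))
        + Z s t (concat (concat (dot (ι j)) (dot (ι i))) (dot (ι k)))
        + Z s t (concat (concat (dot (ι j)) (dot (ι k))) (dot (ι i))) := by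
  have := H.isRoughPath.mul s hs t ht (dot (ι i)) (concat (dot (ι j)) (dot (ι k)))
    (by simp [dot, graft, order, concat])
  rw [sum_shuffle_dot_dot_dot, H.increment s hs t ht] at this
  exact this.symm

theorem IsRoughPathAbove.small_taylor_zero (H : IsRoughPathAbove w α T ι Z X) (hα : 0 < α)
    (hG : ContDiff ℝ ∞ G) : Small α T 1 (fun s u _ => G (X u) - G (X s)) := by
  obtain ⟨R, hR⟩ := H.exists_mem_closedBall hα
  obtain ⟨C, hC0, hC⟩ := exists_taylor_zero hG R
  exact (H.small_increment hα).of_norm_le_pow hC0 fun s hs u hu _ _ => by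
    simpa using hC _ (hR s hs) _ (hR u hu)

theorem IsRoughPathAbove.small_taylor_one (H : IsRoughPathAbove w α T ι Z X) (hα : 0 < α)
    (hG : ContDiff ℝ ∞ G) : Small α T 2 (fun s u _ => G (X u) - G (X s)
      - ∑ i, Z s u (dot (ι i)) • pderiv i G (X s)) := by
  obtain ⟨R, hR⟩ := H.exists_mem_closedBall hα
  obtain ⟨C, hC0, hC⟩ := exists_taylor_one hG R
  exact (H.small_increment hα).of_norm_le_pow hC0 fun s hs u hu _ _ => by
    simpa only [H.increment s hs u hu, PiLp.sub_apply] using hC _ (hR s hs) _ (hR u hu)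

/-- Only the symmetric part of the two-vertex coordinates meets the Hessian, and the shuffle
relation identifies that part with half the square of the increment. -/
theorem IsRoughPathAbove.small_taylor_two (H : IsRoughPathAbove w α T ι Z X) (hα : 0 < α)
    (hG : ContDiff ℝ ∞ G) : Small α T 3 (fun s u _ => G (X u) - G (X s)
      - ∑ i, Z s u (dot (ι i)) • pderiv i G (X s)
      - ∑ i, ∑ j, Z s u (concat (dot (ι i)) (dot (ι j))) • pderiv i (pderiv j G) (X s)) := by
  obtain ⟨R, hR⟩ := H.exists_mem_closedBall hα
  obtain ⟨C, hC0, hC⟩ := exists_taylor_two hG R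
  refine (H.small_increment hα).of_norm_le_pow hC0 fun s hs u hu _ _ => ?_
  rw [sum_smul_eq_half (H.shuffle_dot_dot hs hu) (fun i j => by rw [pderiv_comm hG i j])]
  simpa only [H.increment s hs u hu, pderiv_comm hG, PiLp.sub_apply] using hC _ (hR s hs) _ (hR u hu)

variable [Finite B] {Y : ℝ → PForest B → E}

theorem IsRoughPathAbove.isControlled (H : IsRoughPathAbove w α T ι Z X) (hα : 0 < α)
    (hG : ContDiff ℝ ∞ G) (hY : IsLift ι G X Y) : IsControlled α 3 T Z Y := by
  classical
  have hrem : ∀ τ s t, s ∈ Set.Icc 0 T → t ∈ Set.Icc 0 T → remainder 3 Z Y τ s t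
      = Y t τ - (dual τ nil • G (X s)
        + ∑ i, (Z s t (dot (ι i)) * dual τ nil + dual τ (dot (ι i))) • pderiv i G (X s)
        + ∑ i, ∑ j, (Z s t (concat (dot (ι i)) (dot (ι j))) * dual τ nil
          + Z s t (dot (ι i)) * dual τ (dot (ι j))
          + dual τ (concat (dot (ι i)) (dot (ι j)))) • pderiv i (pderiv j G) (X s)) := by
    intro τ s t hs ht
    have h := sum_forestsLE_two H.injective (fun σ => PForest.star (Z s t) (dual τ) σ • Y s σ)
      (fun σ hσ => by simp only [hY.support s σ hσ, smul_zero])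
    simp only [hY.nil, hY.dot, hY.dot_dot, star_nil, star_dot, star_dot_dot,
      H.isRoughPath.unit s hs t ht, one_mul] at h
    exact congrArg (Y t τ - ·) h
  have key : ∀ τ, order τ ≤ 2 → Small α T (3 - order τ) (fun s u _ => remainder 3 Z Y τ s u) := by
    intro τ hτ
    -- On the forests 𝟏, •_k and •_k•_l the remainder is the Taylor remainder of G, ∂_k G and ∂_k∂_l
    -- G, of order 3, 2 and 1 in α; on every other forest it is zero.
    by_cases h : τ ∈ Set.range (bullets ι)
    · obtain ⟨_ | k | ⟨k, l⟩, rfl⟩ := h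
      · refine (H.small_taylor_two hα hG).congr fun s hs u hu _ _ => ?_
        rw [hrem _ _ _ hs hu]
        have h1 : ∀ a : B, dual nil (dot a) = 0 := fun a => dual_of_ne (by simp [dot, graft])
        have h2 : ∀ a b : B, dual nil (concat (dot a) (dot b)) = 0 := fun a b =>
          dual_of_ne (by simp [dot, graft, concat])
        simp only [bullets, dual_self, h1, h2, hY.nil, one_smul, mul_one, mul_zero, add_zero]
        abel
      · refine (H.small_taylor_one hα (contDiff_pderiv hG k)).congr fun s hs u hu _ _ => ?_
        rw [hrem _ _ _ hs hu]
        have h1 : ∀ a : B, dual (dot a) nil = 0 := fun a => dual_of_ne (by simp [dot, graft])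
        have h2 : ∀ a b c : B, dual (dot c) (concat (dot a) (dot b)) = 0 := fun a b c =>
          dual_of_ne (by simp [dot, graft, concat])
        simp only [bullets, h1, h2, hY.dot, zero_smul, mul_zero, add_zero, zero_add,
          dual_dot_dot, H.injective.eq_iff, mul_ite, mul_one, ite_smul, one_smul,
          Finset.sum_ite_eq', Finset.mem_univ, if_true]
        abel
      · refine (H.small_taylor_zero hα
          (contDiff_pderiv (contDiff_pderiv hG l) k)).congr fun s hs u hu _ _ => ?_
        rw [hrem _ _ _ hs hu]
        have h1 : ∀ a b : B, dual (concat (dot a) (dot b)) nil = 0 := fun a b =>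
          dual_of_ne (by simp [dot, graft, concat])
        have h2 : ∀ a b c : B, dual (concat (dot a) (dot b)) (dot c) = 0 := fun a b c =>
          dual_of_ne (by simp [dot, graft, concat])
        simp only [bullets, h1, h2, hY.dot_dot, zero_smul, mul_zero, add_zero, zero_add,
          dual_concat_concat, H.injective.eq_iff, ite_smul, one_smul, Finset.sum_const_zero,
          Finset.sum_ite_eq', Finset.mem_univ, if_true, Finset.sum_ite_irrel]
    · refine Small.zero.congr fun s hs u hu _ _ => ?_
      rw [hrem _ _ _ hs hu, hY.support _ _ h]
      have h0 : dual τ (nil : PForest B) = 0 := dual_of_ne fun e => h ⟨none, e⟩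
      have h1 : ∀ i, dual τ (dot (ι i)) = 0 := fun i => dual_of_ne fun e => h ⟨some (.inl i), e⟩
      have h2 : ∀ i j, dual τ (concat (dot (ι i)) (dot (ι j))) = 0 := fun i j =>
        dual_of_ne fun e => h ⟨some (.inr (i, j)), e⟩
      simp [h0, h1, h2]
  intro τ hτ
  obtain ⟨C, -, hC⟩ := (key τ hτ).norm_le
  refine ⟨C, fun s hs t ht => ?_⟩
  have := hC s hs t ht
  rwa [Nat.cast_sub (by change order τ ≤ 2 at hτ; omega)] at this

/-- Existence of the rough integral of `G(X)`. -/
theorem IsRoughPathAbove.exists_isRoughIntegral [ProperSpace E]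
    (H : IsRoughPathAbove w α T ι Z X) (hα : 1 / 4 < α) (hT : 0 < T) (hG : ContDiff ℝ ∞ G)
    (hY : IsLift ι G X Y) (a : B) :
    ∃ I : ℝ → E, IsRoughIntegral α 3 T Z Y a I ∧
      Small α T 4 (fun s t _ => I t - I s - germ 3 Z Y a s t) := by
  have hα0 : 0 < α := by linarith
  have hw := H.one_le_weight
  have s1 : Small α T 1 (fun s u _ => Z s u (dot a)) :=
    H.isRoughPath.small hα0 (by simp [dot, graft, order])
      (by simpa [dot, graft, weight] using hw a) (fun s hs => H.isRoughPath.diag_dot hs _)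
  have s2 : ∀ i, Small α T 2 (fun s u _ => Z s u (graft a (dot (ι i)))) := fun i =>
    H.isRoughPath.small hα0 (by simp [dot, graft, order])
      (by have := hw a; have := hw (ι i); simp [dot, graft, weight]; omega)
      (fun s hs => H.isRoughPath.diag_graft_dot hs _ _)
  have s3 : ∀ i j, Small α T 3
      (fun s u _ => Z s u (graft a (concat (dot (ι i)) (dot (ι j))))) := fun i j =>
    H.isRoughPath.small hα0 (by simp [dot, graft, order, concat])
      (by
        have := hw a; have := hw (ι i); have := hw (ι j)
        simp [dot, graft, weight, concat]; omega)
      (fun s hs => H.isRoughPath.diag_graft_dot_dot hs _ _ _)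
  have hdefect : Small α T 4 (fun s u t =>
      germ 3 Z Y a s t - germ 3 Z Y a s u - germ 3 Z Y a u t) := by
    have t0 := s1.comp_right.smul (H.small_taylor_two hα0 hG)
    have t1 := fun j => (s2 j).comp_right.smul (H.small_taylor_one hα0 (contDiff_pderiv hG j))
    have t2 := fun i j => (s3 i j).comp_right.smul
      (H.small_taylor_zero hα0 (contDiff_pderiv (contDiff_pderiv hG j) i))
    refine ((t0.add (Small.sum Finset.univ t1)).add
      (Small.sum Finset.univ fun i => Small.sum Finset.univ (t2 i))).neg.congr
      fun s hs u hu t ht => ?_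
    simp only [hY.germ_eq H.injective, H.isRoughPath.chen_dot hs hu ht, H.isRoughPath.chen_graft_dot hs hu ht,
      H.isRoughPath.chen_graft_dot_dot hs hu ht]
    exact germ_defect _ _ _ _ _ _ _ _ _ _ _ _ _ _
  have hdiag : ∀ s ∈ Set.Icc 0 T, germ 3 Z Y a s s = 0 := by
    intro s hs
    simp [hY.germ_eq H.injective, H.isRoughPath.diag_dot hs, H.isRoughPath.diag_graft_dot hs,
      H.isRoughPath.diag_graft_dot_dot hs]
  obtain ⟨I, hI, hI'⟩ := exists_sewing_of_small hT hα hdiag hdefect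
  refine ⟨I, ⟨H.isControlled hα0 hG hY, hI, ?_⟩, hI'⟩
  obtain ⟨C, -, hC⟩ := hI'.norm_le
  refine ⟨C, fun s hs t ht => (hC s hs t ht).trans (le_of_eq ?_)⟩
  norm_num

end RoughAbove

/-! ### Young integrals. -/

section Young

variable {d : ℕ} {α T : ℝ} {E : Type*} [NormedAddCommGroup E] [NormedSpace ℝ E]

theorem exists_isYoungIntegral [ProperSpace E] (hT : 0 < T) (hα : 1 / 4 < α) {g : ℝ → E}
    {x : ℝ → ℝ} (hg : Small α T 1 (fun s t _ => g t - g s))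
    (hx : Small α T 3 (fun s t _ => x t - x s)) :
    ∃ I : ℝ → E, IsYoungIntegral α (3 * α) T g x I ∧
      Small α T 4 (fun s t _ => I t - I s - (x t - x s) • g s) := by
  -- The defect is -(x_t - x_u)(g_u - g_s), of order 3 + 1.
  have hdefect : Small α T 4 (fun s u t =>
      (x t - x s) • g s - (x u - x s) • g s - (x t - x u) • g u) :=
    (hx.comp_right.smul hg).neg.congr fun s _ u _ t _ => by module
  obtain ⟨I, hI, hI'⟩ := exists_sewing_of_small (Ξ := fun u v => (x v - x u) • g u) hT hα
    (fun s _ => by simp) hdefect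
  refine ⟨I, ⟨by linarith, ?_, ?_, hI⟩, hI'⟩
  · obtain ⟨C, -, hC⟩ := hg.norm_le
    exact ⟨C, by simpa using hC⟩
  · obtain ⟨C, -, hC⟩ := hx.norm_le
    exact ⟨C, by simpa using hC⟩

end Young

/-- Cancellation of the corrections to the increments of the three integrals. -/
theorem sum_germs {d : ℕ} {E : Type*} [AddCommGroup E] [Module ℝ E] (a : Fin d → ℝ)
    (b p : Fin d → Fin d → ℝ) (c e t : Fin d → Fin d → Fin d → ℝ) {q₁ : Fin d → E}
    {q₂ : Fin d → Fin d → E} {q₃ : Fin d → Fin d → Fin d → E} (r : Fin d → Fin d → E)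
    (h₂ : ∀ i j, q₂ i j = q₂ j i) (h₃ : ∀ i j k, q₃ i j k = q₃ j i k)
    (h₃' : ∀ i j k, q₃ i j k = q₃ i k j) :
    ∑ i, (a i • q₁ i + ∑ j, b j i • q₂ j i + ∑ j, ∑ k, c j k i • q₃ j k i)
      + ∑ i, ∑ j, ((p j i - b j i) • q₂ i j + ∑ k, e k i j • q₃ k i j + r i j)
      + ∑ i, ∑ j, ∑ k, (t k j i - c k j i - e k i j) • q₃ i j k
    = ∑ i, a i • q₁ i + ∑ i, ∑ j, p j i • q₂ i j + ∑ i, ∑ j, ∑ k, t k j i • q₃ i j k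
      + ∑ i, ∑ j, r i j := by
  have hb : ∑ i, ∑ j, b j i • q₂ j i = ∑ i, ∑ j, b j i • q₂ i j := by
    simp only [fun i j => h₂ i j]
  have hc : ∑ i, ∑ j, ∑ k, c j k i • q₃ j k i = ∑ i, ∑ j, ∑ k, c k j i • q₃ i j k := by
    refine Finset.sum_congr rfl fun i _ => ?_
    rw [Finset.sum_comm]
    refine Finset.sum_congr rfl fun j _ => Finset.sum_congr rfl fun k _ => ?_
    rw [h₃ i j k, h₃' j i k, h₃ j k i]
  have he : ∑ i, ∑ j, ∑ k, e k i j • q₃ k i j = ∑ i, ∑ j, ∑ k, e k i j • q₃ i j k := by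
    refine Finset.sum_congr rfl fun i _ => Finset.sum_congr rfl fun j _ =>
      Finset.sum_congr rfl fun k _ => ?_
    rw [h₃ k i j, h₃' i k j]
  simp only [Finset.sum_add_distrib, sub_smul, Finset.sum_sub_distrib, hb, hc, he]
  abel

/-! ### Bracket extension and the local Itô expansion. -/

section Bracket

variable {d : ℕ} {α T : ℝ} {XX : ℝ → ℝ → PForest (Fin d) → ℝ}
  {X : ℝ → EuclideanSpace ℝ (Fin d)} {Xh : ℝ → ℝ → PForest (BracketAlphabet d) → ℝ}

theorem isRoughPathAbove_id (hXX : IsPlanarlyBranchedRoughPath α 3 T XX)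
    (hX : ∀ s ∈ Set.Icc 0 T, ∀ t ∈ Set.Icc 0 T, ∀ i : Fin d, XX s t (dot i) = X t i - X s i) :
    IsRoughPathAbove (fun _ => 1) α T id XX X :=
  ⟨hXX, fun _ => le_rfl, Function.injective_id, hX⟩

variable (hXh : IsBracketExtension α 3 T XX Xh)
include hXh

theorem IsBracketExtension.isRoughPathAbove
    (hX : ∀ s ∈ Set.Icc 0 T, ∀ t ∈ Set.Icc 0 T, ∀ i : Fin d, XX s t (dot i) = X t i - X s i) :
    IsRoughPathAbove bracketWeight α T Sum.inl Xh X where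
  isRoughPath := hXh.isRoughPath
  one_le_weight := by rintro (i | i) <;> simp [bracketWeight]
  injective := Sum.inl_injective
  increment s hs t ht i := by
    rw [← hX s hs t ht i, ← hXh.extends_eq s hs t ht (dot i) (by simp [dot, graft, order])]
    rfl

theorem IsBracketExtension.bracket_eq_incl {s t : ℝ} (hs : s ∈ Set.Icc 0 T)
    (ht : t ∈ Set.Icc 0 T) (i j : Fin d) :
    Xh s t (dot (Sum.inr (i, j))) = Xh s t (concat (dot (Sum.inl j)) (dot (Sum.inl i)))
      - Xh s t (graft (Sum.inl i) (dot (Sum.inl j))) := by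
  rw [hXh.bracket_eq s hs t ht, ← hXh.extends_eq s hs t ht (concat (dot j) (dot i))
    (by simp [dot, graft, order, concat]), ← hXh.extends_eq s hs t ht (graft i (dot j))
    (by simp [dot, graft, order])]
  rfl

omit hXh in
theorem tildeIncrement_eq (i j k : Fin d) (s t : ℝ) : tildeIncrement Xh i j k s t
    = Xh s t (concat (concat (dot (Sum.inl k)) (dot (Sum.inl j))) (dot (Sum.inl i)))
      - Xh s t (graft (Sum.inl i) (concat (dot (Sum.inl k)) (dot (Sum.inl j))))
      - Xh s t (graft (Sum.inr (i, j)) (dot (Sum.inl k))) := rfl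

/-- The cross terms ⟨•_k•_j⟩⟨•_i⟩ of the first two forests cancel; the others are ⟨•_k⟩ times
⟨•_j•_i - [•_j]_i - •_{(ij)}⟩, which is zero by the bracket relation. -/
theorem IsBracketExtension.tildeIncrement_add {s u t : ℝ} (hs : s ∈ Set.Icc 0 T)
    (hu : u ∈ Set.Icc 0 T) (ht : t ∈ Set.Icc 0 T) (i j k : Fin d) :
    tildeIncrement Xh i j k s u + tildeIncrement Xh i j k u t = tildeIncrement Xh i j k s t := by
  simp only [tildeIncrement_eq, hXh.isRoughPath.chen_dot_dot_dot hs hu ht,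
    hXh.isRoughPath.chen_graft_dot_dot hs hu ht, hXh.isRoughPath.chen_graft_dot hs hu ht,
    hXh.bracket_eq_incl hu ht]
  ring

theorem IsBracketExtension.exists_isTildePath (hT : 0 < T) (c : Fin d → Fin d → Fin d → ℝ) :
    ∃ Xt : Fin d → Fin d → Fin d → ℝ → ℝ, (∀ i j k, Xt i j k 0 = c i j k) ∧
      IsTildePath T Xh Xt := by
  have h0 : (0 : ℝ) ∈ Set.Icc 0 T := ⟨le_rfl, hT.le⟩
  refine ⟨fun i j k t => c i j k + tildeIncrement Xh i j k 0 t, fun i j k => ?_,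
    fun i j k s hs t ht => ?_⟩
  · have := hXh.tildeIncrement_add h0 h0 h0 i j k
    simpa using this
  · beta_reduce
    rw [← hXh.tildeIncrement_add h0 hs ht]
    ring

theorem IsBracketExtension.small_tilde (hα : 0 < α) {Xt : Fin d → Fin d → Fin d → ℝ → ℝ}
    (hXt : IsTildePath T Xh Xt) (i j k : Fin d) :
    Small α T 3 (fun s t _ => Xt i j k t - Xt i j k s) := by
  have h1 := hXh.isRoughPath.small hα (k := 3)
    (τ := concat (concat (dot (Sum.inl k)) (dot (Sum.inl j))) (dot (Sum.inl i)))
    (by simp [dot, graft, order, concat]) (by simp [dot, graft, weight, concat, bracketWeight])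
    (fun s hs => hXh.isRoughPath.diag_dot_dot_dot hs _ _ _)
  have h2 := hXh.isRoughPath.small hα (k := 3)
    (τ := graft (Sum.inl i) (concat (dot (Sum.inl k)) (dot (Sum.inl j))))
    (by simp [dot, graft, order, concat]) (by simp [dot, graft, weight, concat, bracketWeight])
    (fun s hs => hXh.isRoughPath.diag_graft_dot_dot hs _ _ _)
  have h3 := hXh.isRoughPath.small hα (k := 3)
    (τ := graft (Sum.inr (i, j)) (dot (Sum.inl k)))
    (by simp [dot, graft, order]) (by simp [dot, graft, weight, bracketWeight])
    (fun s hs => hXh.isRoughPath.diag_graft_dot hs _ _)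
  exact ((h1.sub h2).sub h3).congr fun s hs t ht _ _ => by
    rw [hXt i j k s hs t ht, tildeIncrement_eq]

/-- The local expansion of `F(X)` in terms of the germs of the three integrals. -/
theorem IsBracketExtension.small_ito_defect {E : Type*} [NormedAddCommGroup E] [NormedSpace ℝ E]
    (hα : 0 < α)
    (hX : ∀ s ∈ Set.Icc 0 T, ∀ t ∈ Set.Icc 0 T, ∀ i : Fin d, XX s t (dot i) = X t i - X s i)
    {F : EuclideanSpace ℝ (Fin d) → E} (hF : ContDiff ℝ ∞ F)
    {Xt : Fin d → Fin d → Fin d → ℝ → ℝ} (hXt : IsTildePath T Xh Xt) :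
    Small α T 4 (fun s t _ => F (X t) - F (X s)
      - (∑ i, germ 3 XX (lift (pderiv i F) X) i s t
        + ∑ i, ∑ j, germ 3 Xh (extendByZero (lift (pderiv i (pderiv j F)) X)) (Sum.inr (i, j)) s t
        + ∑ i, ∑ j, ∑ k, (Xt i j k t - Xt i j k s) •
            pderiv i (pderiv j (pderiv k F)) (X s))) := by
  have H := hXh.isRoughPathAbove hX
  have hq₂ : ∀ i j, pderiv i (pderiv j F) = pderiv j (pderiv i F) := pderiv_comm hF
  have hq₃ : ∀ i j k, pderiv i (pderiv j (pderiv k F)) = pderiv j (pderiv i (pderiv k F)) :=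
    fun i j k => pderiv_comm (contDiff_pderiv hF k) i j
  have hq₃' : ∀ i j k, pderiv i (pderiv j (pderiv k F)) = pderiv i (pderiv k (pderiv j F)) :=
    fun i j k => by rw [hq₂ j k]
  obtain ⟨R, hR⟩ := H.exists_mem_closedBall hα
  obtain ⟨C, hC0, hC⟩ := exists_taylor_three hF R
  have hTaylor := (H.small_increment hα).of_norm_le_pow hC0
    fun s hs t ht _ _ => hC _ (hR s hs) _ (hR t ht)
  -- The top terms of the bracket germs are the only ones without a counterpart in Taylor's formula;
  -- since (ij) has weight two, they are of order 4.
  have hrest := Small.sum Finset.univ fun i : Fin d => Small.sum Finset.univ fun j : Fin d =>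
    Small.sum Finset.univ fun k : Fin d => Small.sum Finset.univ fun l : Fin d =>
    (hXh.isRoughPath.small hα (k := 4)
      (τ := graft (Sum.inr (i, j)) (concat (dot (Sum.inl k)) (dot (Sum.inl l))))
      (by simp [dot, graft, order, concat]) (by simp [dot, graft, weight, concat, bracketWeight])
      (fun s hs => hXh.isRoughPath.diag_graft_dot_dot hs _ _ _)).smul
    (H.small_comp hα (contDiff_pderiv (contDiff_pderiv (contDiff_pderiv (contDiff_pderiv hF j) i)
      l) k).continuous)
  refine (hTaylor.sub hrest).congr fun s hs t ht _ _ => ?_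
  have e1 : ∀ i, XX s t (dot i) = Xh s t (dot (Sum.inl i)) := fun i =>
    (hXh.extends_eq s hs t ht (dot i) (by simp [dot, graft, order])).symm
  have e2 : ∀ i j, XX s t (graft i (dot j)) = Xh s t (graft (Sum.inl i) (dot (Sum.inl j))) :=
    fun i j => (hXh.extends_eq s hs t ht (graft i (dot j)) (by simp [dot, graft, order])).symm
  have e3 : ∀ i j k, XX s t (graft i (concat (dot j) (dot k)))
      = Xh s t (graft (Sum.inl i) (concat (dot (Sum.inl j)) (dot (Sum.inl k)))) := fun i j k =>
    (hXh.extends_eq s hs t ht (graft i (concat (dot j) (dot k)))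
      (by simp [dot, graft, order, concat])).symm
  simp only [(isLift_lift _ X).germ_eq Function.injective_id,
    (isLift_extendByZero _ X).germ_eq Sum.inl_injective, hXt _ _ _ s hs t ht, tildeIncrement_eq,
    hXh.bracket_eq_incl hs ht, id_eq, e1, e2, e3]
  rw [sum_germs (fun i => Xh s t (dot (Sum.inl i)))
    (fun j i => Xh s t (graft (Sum.inl i) (dot (Sum.inl j))))
    (fun j i => Xh s t (concat (dot (Sum.inl j)) (dot (Sum.inl i))))
    (fun j k i => Xh s t (graft (Sum.inl i) (concat (dot (Sum.inl j)) (dot (Sum.inl k)))))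
    (fun k i j => Xh s t (graft (Sum.inr (i, j)) (dot (Sum.inl k))))
    (fun k j i => Xh s t (concat (concat (dot (Sum.inl k)) (dot (Sum.inl j))) (dot (Sum.inl i))))
    (q₁ := fun i => pderiv i F (X s)) (q₂ := fun i j => pderiv i (pderiv j F) (X s))
    (q₃ := fun i j k => pderiv i (pderiv j (pderiv k F)) (X s)) _
    (fun i j => congrFun (hq₂ i j) _) (fun i j k => congrFun (hq₃ i j k) _)
    (fun i j k => congrFun (hq₃' i j k) _)]
  have hsh : ∀ i j, (X t - X s) i * (X t - X s) j
      = Xh s t (concat (dot (Sum.inl j)) (dot (Sum.inl i)))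
        + Xh s t (concat (dot (Sum.inl i)) (dot (Sum.inl j))) := fun i j => by
    rw [H.shuffle_dot_dot hs ht, add_comm]
  have T2 := sum_smul_eq_half (f := fun i j => pderiv i (pderiv j F) (X s)) hsh
    (fun i j => congrFun (hq₂ i j) _)
  have T3 := sum_smul_eq_sixth (f := fun i j k => pderiv i (pderiv j (pderiv k F)) (X s))
    -- The word is read backwards, as in the tilde increment; the shuffle relation is invariant
    -- under reversal of words.
    (x₃ := fun i j k =>
      Xh s t (concat (concat (dot (Sum.inl k)) (dot (Sum.inl j))) (dot (Sum.inl i)))) hsh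
    (fun i j k => by rw [H.shuffle_dot_dot_dot hs ht]; ring)
    (fun i j k => congrFun (hq₃ i j k) _) (fun i j k => congrFun (hq₃' i j k) _)
  have f2 : ∀ i j, pderiv j (pderiv i F) = pderiv i (pderiv j F) := fun i j => hq₂ j i
  have f3 : ∀ i j k, pderiv k (pderiv j (pderiv i F)) = pderiv i (pderiv j (pderiv k F)) :=
    fun i j k => by rw [hq₃ k j i, hq₃' j k i, hq₃ j i k]
  rw [T2, T3]
  simp only [H.increment s hs t ht, ← PiLp.sub_apply]
  rw [show (∑ i, (X t - X s) i • ∑ j, (X t - X s) j • pderiv j (pderiv i F) (X s))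
      = ∑ i, (X t - X s) i • ∑ j, (X t - X s) j • pderiv i (pderiv j F) (X s) from
      Finset.sum_congr rfl fun i _ => by
        congr 1
        exact Finset.sum_congr rfl fun j _ => by rw [f2],
    show (∑ i, (X t - X s) i • ∑ j, (X t - X s) j • ∑ k, (X t - X s) k •
        pderiv k (pderiv j (pderiv i F)) (X s))
      = ∑ i, (X t - X s) i • ∑ j, (X t - X s) j • ∑ k, (X t - X s) k •
        pderiv i (pderiv j (pderiv k F)) (X s) from
      Finset.sum_congr rfl fun i _ => by
        congr 1
        refine Finset.sum_congr rfl fun j _ => ?_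
        congr 1
        exact Finset.sum_congr rfl fun k _ => by rw [f3]]
  abel

end Bracket

end PlanarRP

/-! ### The Itô formula. -/

theorem mainTheorem2 (d n : ℕ) (α T : ℝ) (hα : 1 / 4 < α) (hα' : α ≤ 1 / 3) (hT : 0 < T)
    (XX : ℝ → ℝ → PlanarRP.PForest (Fin d) → ℝ)
    (hXX : PlanarRP.IsPlanarlyBranchedRoughPath α 3 T XX)
    (X : ℝ → EuclideanSpace ℝ (Fin d))
    (hX : ∀ s ∈ Set.Icc 0 T, ∀ t ∈ Set.Icc 0 T, ∀ i : Fin d,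
      XX s t (PlanarRP.PForest.dot i) = X t i - X s i)
    (Xh : ℝ → ℝ → PlanarRP.PForest (PlanarRP.BracketAlphabet d) → ℝ)
    (hXh : PlanarRP.IsBracketExtension α 3 T XX Xh)
    (F : EuclideanSpace ℝ (Fin d) → EuclideanSpace ℝ (Fin n)) (hF : ContDiff ℝ ∞ F) :
    (∀ c : Fin d → Fin d → Fin d → ℝ, ∃ Xt : Fin d → Fin d → Fin d → ℝ → ℝ,
      (∀ i j k, Xt i j k 0 = c i j k) ∧ PlanarRP.IsTildePath T Xh Xt) ∧
    ∀ Xt : Fin d → Fin d → Fin d → ℝ → ℝ, PlanarRP.IsTildePath T Xh Xt →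
      ∃ (I₁ : Fin d → ℝ → EuclideanSpace ℝ (Fin n))
        (I₂ : Fin d → Fin d → ℝ → EuclideanSpace ℝ (Fin n))
        (I₃ : Fin d → Fin d → Fin d → ℝ → EuclideanSpace ℝ (Fin n)),
        (∀ i, PlanarRP.IsRoughIntegral α 3 T XX
          (PlanarRP.lift (PlanarRP.pderiv i F) X) i (I₁ i)) ∧
        (∀ i j, PlanarRP.IsRoughIntegral α 3 T Xh
          (PlanarRP.extendByZero (PlanarRP.lift (PlanarRP.pderiv i (PlanarRP.pderiv j F)) X))
          (Sum.inr (i, j)) (I₂ i j)) ∧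
        (∀ i j k, PlanarRP.IsYoungIntegral α (3 * α) T
          (fun r => PlanarRP.pderiv i (PlanarRP.pderiv j (PlanarRP.pderiv k F)) (X r))
          (Xt i j k) (I₃ i j k)) ∧
        ∀ s ∈ Set.Icc 0 T, ∀ t ∈ Set.Icc 0 T,
          F (X t) - F (X s) =
            ∑ i, (I₁ i t - I₁ i s) + ∑ i, ∑ j, (I₂ i j t - I₂ i j s)
              + ∑ i, ∑ j, ∑ k, (I₃ i j k t - I₃ i j k s) := by
  have hα0 : 0 < α := by linarith
  refine ⟨hXh.exists_isTildePath hT, fun Xt hXt => ?_⟩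
  have H := PlanarRP.isRoughPathAbove_id hXX hX
  have Hh := hXh.isRoughPathAbove hX
  have c1 := PlanarRP.contDiff_pderiv hF
  have c2 := fun i j => PlanarRP.contDiff_pderiv (c1 j) i
  have c3 := fun i j k => PlanarRP.contDiff_pderiv (c2 j k) i
  choose I₁ hI₁ hI₁' using fun i =>
    H.exists_isRoughIntegral hα hT (c1 i) (PlanarRP.isLift_lift _ X) i
  choose I₂ hI₂ hI₂' using fun i j =>
    Hh.exists_isRoughIntegral hα hT (c2 i j) (PlanarRP.isLift_extendByZero _ X) (Sum.inr (i, j))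
  choose I₃ hI₃ hI₃' using fun i j k =>
    PlanarRP.exists_isYoungIntegral hT hα (H.small_taylor_zero hα0 (c3 i j k))
      (hXh.small_tilde hα0 hXt i j k)
  refine ⟨I₁, I₂, I₃, hI₁, hI₂, hI₃, fun s hs t ht => ?_⟩
  let Z : ℝ → EuclideanSpace ℝ (Fin n) := fun t =>
    F (X t) - (∑ i, I₁ i t + ∑ i, ∑ j, I₂ i j t + ∑ i, ∑ j, ∑ k, I₃ i j k t)
  -- The increment of `Z` is the local Itô defect minus the sewing errors of the three families of
  -- integrals.
  have hZ : PlanarRP.Small α T 4 (fun s t _ => Z t - Z s) := by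
    refine (((hXh.small_ito_defect hα0 hX hF hXt).sub
      (PlanarRP.Small.sum Finset.univ hI₁')).sub
      (PlanarRP.Small.sum Finset.univ fun i => PlanarRP.Small.sum Finset.univ (hI₂' i))).sub
      (PlanarRP.Small.sum Finset.univ fun i => PlanarRP.Small.sum Finset.univ fun j =>
        PlanarRP.Small.sum Finset.univ (hI₃' i j)) |>.congr fun s _ t _ _ _ => ?_
    simp only [Z, Finset.sum_sub_distrib]
    abel
  obtain ⟨K, hK, hK'⟩ := hZ.norm_le
  have hconst : ∀ t ∈ Set.Icc 0 T, Z t = Z 0 := fun t ht =>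
    PlanarRP.eq_of_norm_sub_le_rpow (θ := ((4 : ℕ) : ℝ) * α) hK (by push_cast; linarith) (fun s hs t ht hst => by
      simpa only [abs_of_nonneg (sub_nonneg.2 hst)] using hK' s hs t ht) ht
  have hst : Z t - Z s = 0 := by rw [hconst t ht, hconst s hs, sub_self]
  rw [← sub_eq_zero, ← hst]
  simp only [Z, Finset.sum_sub_distrib]
  abel
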